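/- Let $\mathbb{F}_q$ be a finite field with $q\equiv 1 \pmod 6$, of characteristic $p$, and let $\widehat{\mathbb{F}_q^\times}$ be the group of multiplicative characters $\chi:\mathbb{F}_q^\times\to\mathbb{C}^\times$, each extended to $\mathbb{F}_q$ by $\chi(0)=0$ (including the trivial character $\varepsilon$). Write $\overline{\chi}=\chi^{-1}$, let $\phi$ be the quadratic character, and put $\delta(0)=1$ and $\delta(x)=0$ for $x\neq 0$. Fix a primitive $p$-th root of unity $\zeta_p\in\mathbb{C}$, and let $$g(\chi)=\sum_{x\in\mathbb{F}_q^\times}\chi(x)\,\zeta_p^{\mathrm{Tr}_{\mathbb{F}_q/\mathbb{F}_p}(x)},\qquad J(\chi,\psi)=\sum_{x\in\mathbb{F}_q}\chi(x)\psi(1-x)$$ be the Gauss and Jacobi sums. For characters $A_1,A_2,\dots$ and $B_1,B_2,\dots$ define the period functions by ${}_1\mathbb{P}_0[A_1;\lambda]=\overline{A_1}(1-\lambda)$ and $${}_{n+1}\mathbb{P}_n\!\left[\begin{matrix}A_1&A_2&\cdots&A_{n+1}\\&B_1&\cdots&B_n\end{matrix};\lambda\right]=\sum_{y\in\mathbb{F}_q}A_{n+1}(y)\,\overline{A_{n+1}}B_n(1-y)\;{}_{n}\mathbb{P}_{n-1}\!\left[\begin{matrix}A_1&A_2&\cdots&A_{n}\\&B_1&\cdots&B_{n-1}\end{matrix};\lambda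 y\right],$$ and the normalized hypergeometric functions by $${}_{n+1}\mathbb{F}_n\!\left[\begin{matrix}A_1&A_2&\cdots&A_{n+1}\\&B_1&\cdots&B_n\end{matrix};\lambda\right]=\frac{1}{\prod_{i=1}^nJ(A_{i+1},B_i\overline{A_{i+1}})}\;{}_{n+1}\mathbb{P}_n\!\left[\begin{matrix}A_1&A_2&\cdots&A_{n+1}\\&B_1&\cdots&B_n\end{matrix};\lambda\right].$$ **Theorem (second finite field Bailey cubic transformation).** Let $\eta$ be a character of order $3$ of $\mathbb{F}_q^\times$, and let $A,B\in\widehat{\mathbb{F}_q^\times}$ be such that none of $$A^3,\quad B,\quad A^3\overline{B}^2,\quad A^6\overline{B}^3,\quad \phi A^3\overline{B},\quad \phi A^3\overline{B}^3$$ is the trivial character. Then for all $x\in\mathbb{F}_q$, $$\begin{aligned}\overline{A}^3(1-x)\;{}_3\mathbb{F}_2\!\left[\begin{matrix}A&A\eta&A\overline{\eta}\\&\phi B&A^3\overline{B}\end{matrix};\frac{27x}{4(x-1)^3}\right]={}&{}_3\mathbb{F}_2\!\left[\begin{matrix}A^3&A^3\overline{B}^2&\overline{A}^3B^2\\&A^3\overline{B}&\phi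 B\end{matrix};\frac{x}{4}\right]\\&-\delta\!\left(x+\tfrac12\right)A^3(2)\,\frac{g(\phi)\,g(\overline{A}^3)}{g(\phi\overline{B})\,g(\overline{A}^3B)}\\&-\delta(1-x)\sum_{\substack{\chi\in\widehat{\mathbb{F}_q^\times}\\\chi^3=\overline{A}^3}}\frac{g(\overline{\chi})\,g(\phi\overline{B\chi})\,g(B\overline{A^3\chi})}{g(\phi\overline{B})\,g(\overline{A}^3B)\,g(A^3)}\,\overline{\chi}(4),\end{aligned}$$ where for $x=1$ the left-hand side is understood to be $0$. Consequently, $${}_3\mathbb{F}_2\!\left[\begin{matrix}A^3&A^3\overline{B}^2&\overline{A}^3B^2\\&A^3\overline{B}&\phi B\end{matrix};\frac14\right]=\sum_{\substack{\chi\in\widehat{\mathbb{F}_q^\times}\\\chi^3=\overline{A}^3}}\frac{g(\overline{\chi})\,g(\phi\overline{B\chi})\,g(B\overline{A^3\chi})}{g(\phi\overline{B})\,g(\overline{A}^3B)\,g(A^3)}\,\overline{\chi}(4).$$ -/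

import Mathlib

open Finset

noncomputable section

namespace FFHyp

variable {F : Type*} [Field F] [Fintype F] [DecidableEq F]

/-- The finite set of all multiplicative characters of `F`. Mathlib's `MulChar` is extended by zero
to non-units, so every character (the trivial one included) vanishes at `0`. -/
instance instFintypeMulChar : Fintype (MulChar F ℂ) := Fintype.ofFinite _

/-- The quadratic character of `F`, with complex values. -/
def quadChar (F : Type*) [Field F] [Fintype F] [DecidableEq F] : MulChar F ℂ :=
  (quadraticChar F).ringHomComp (Int.castRingHom ℂ)

/-- The delta function on `F`. -/
def delta (x : F) : ℂ := if x = 0 then 1 else 0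

/-- The additive character `x ↦ ζ ^ Tr(x)`, where `Tr` is the trace from `F` to `𝔽_p` and `ζ` is a
`p`-th root of unity. -/
def traceChar (p : ℕ) [Fact p.Prime] [Algebra (ZMod p) F] {ζ : ℂ} (hζ : ζ ^ p = 1) :
    AddChar F ℂ :=
  (AddChar.zmodChar p hζ).compAddMonoidHom (Algebra.trace (ZMod p) F).toAddMonoidHom

/-- The Gauss sum `g(χ) = ∑ χ(x) ζ ^ Tr(x)`. -/
def gauss (p : ℕ) [Fact p.Prime] [Algebra (ZMod p) F] {ζ : ℂ} (hζ : ζ ^ p = 1)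
    (χ : MulChar F ℂ) : ℂ :=
  gaussSum χ (traceChar p hζ)

/-- The period function `_{n+1}ℙ_n [A₀, …, A_n ; B₁, …, B_n ; x]` over `F`. The lower characters
`B₁, …, B_n` are indexed from zero. -/
def period : (n : ℕ) → (Fin (n + 1) → MulChar F ℂ) → (Fin n → MulChar F ℂ) → F → ℂ
  | 0, A, _, x => (A 0)⁻¹ (1 - x)
  | n + 1, A, B, x =>
      ∑ y : F, A (Fin.last (n + 1)) y * ((A (Fin.last (n + 1)))⁻¹ * B (Fin.last n)) (1 - y) *
        period n (fun i => A i.castSucc) (fun i => B i.castSucc) (x * y)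

/-- The normalized hypergeometric function `_{n+1}𝔽_n [A₀, …, A_n ; B₁, …, B_n ; x]`:
the period function divided by the product of the Jacobi sums `J(A_i, B_i * A_i⁻¹)`, `1 ≤ i ≤ n`. -/
def hypF (n : ℕ) (A : Fin (n + 1) → MulChar F ℂ) (B : Fin n → MulChar F ℂ) (x : F) : ℂ :=
  (1 / ∏ i : Fin n, jacobiSum (A i.succ) (B i * (A i.succ)⁻¹)) * period n A B x

end FFHyp

end

set_option linter.unusedSectionVars false

namespace FFHyp

variable {F : Type*} [Field F] [Fintype F] [DecidableEq F]
variable {ψ : AddChar F ℂ}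

/-! Put `C = A ^ 3`. For nonzero argument both ₃𝔽₂ functions expand as sums over characters χ of
products of Gauss sums (`hypF_two_eq_sum_gaussSum`). On the left, the Gauss sums of Aχ, Aηχ, Aη⁻¹χ
collapse by the cubic Hasse–Davenport formula to that of Cχ³. The powers of `1 - x` turn it into the
weight ∑_y (Cχ³)(y) ψ(y(1 - x)), which still makes sense at x = 1. On the right, six Gauss sums
depending on χ remain. `cubic_gaussSum_identity` compares the two sums.

To prove that identity, take α = φB⁻¹ and β = C⁻¹B. Orthogonality over χ rewrites each side as a
double sum over v, w weighted by α(v)β(w): on one side of φ(1 - x + x/(4vw) + v + w), on the other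
of `ternarySum u v w` with u = x/(4vw). The latter sums φ over the values of a ternary quadratic
form, so its main term is q times φ of minus the determinant (up to a square). Since 4uvw = x, that
determinant is exactly the first integrand. The correction terms vanish by orthogonality, thanks to
the nontriviality hypotheses, except for the rank-one form u = v = w = -1/2. That form occurs only
for x = -1/2 and yields the first delta term.

At x = 1 the weight is q - 1 when χ³ = C⁻¹ and 0 otherwise; this gives the second delta term and the
evaluation at 1/4. The case x = 0 is checked directly.

Hasse–Davenport for cubic characters is proved as an equality case: the mean square over χ of the
difference of its two sides is shown to be at most 0, the cross term being a point count on a nodal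
cubic. -/

/-! ### Characters, Gauss sums and Jacobi sums. -/

lemma sum_comp_mul_left {M : Type*} [AddCommMonoid M] (f : F → M) {c : F} (hc : c ≠ 0) :
    ∑ x, f (c * x) = ∑ x, f x :=
  Fintype.sum_equiv (Equiv.mulLeft₀ c hc) _ _ fun _ => rfl

lemma mulChar_ne_zero (χ : MulChar F ℂ) {x : F} (hx : x ≠ 0) : χ x ≠ 0 :=
  MulChar.apply_ne_zero_iff.mpr (IsUnit.mk0 x hx)

lemma mulChar_inv_apply (χ : MulChar F ℂ) (x : F) : χ⁻¹ x = (χ x)⁻¹ := by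
  rw [MulChar.inv_apply_eq_inv, Ring.inverse_eq_inv']

lemma mulChar_pow_apply (χ : MulChar F ℂ) {n : ℕ} (hn : n ≠ 0) (x : F) : (χ ^ n) x = χ x ^ n :=
  MulChar.pow_apply' χ hn x

lemma mulChar_neg_one_mul_self (χ : MulChar F ℂ) : χ (-1) * χ (-1) = 1 := by
  rw [← map_mul]; simp

lemma card_mulChar : (Fintype.card (MulChar F ℂ) : ℂ) = Fintype.card F - 1 := by
  have h := MulChar.card_eq_card_units_of_hasEnoughRootsOfUnity F ℂ
  rw [Nat.card_eq_fintype_card, Nat.card_eq_fintype_card, Fintype.card_units] at h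
  rw [h, Nat.cast_sub Fintype.card_pos, Nat.cast_one]

/-- Orthogonality of the multiplicative characters of a finite field. -/
lemma sum_mulChar_apply (a : F) :
    ∑ χ : MulChar F ℂ, χ a = if a = 1 then (Fintype.card F - 1 : ℂ) else 0 := by
  split_ifs with h
  · subst h
    simp [card_mulChar]
  · obtain ⟨χ₀, h₀⟩ := MulChar.exists_apply_ne_one_of_hasEnoughRootsOfUnity F ℂ h
    have key : χ₀ a * ∑ χ : MulChar F ℂ, χ a = ∑ χ : MulChar F ℂ, χ a := by
      rw [mul_sum]
      exact Fintype.sum_equiv (Equiv.mulLeft χ₀) _ _ fun χ => by simp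
    have : (χ₀ a - 1) * ∑ χ : MulChar F ℂ, χ a = 0 := by rw [sub_mul, key]; ring
    exact (mul_eq_zero.mp this).resolve_left (sub_ne_zero.mpr h₀)

lemma card_ne_zero' : (Fintype.card F : ℂ) ≠ 0 := Nat.cast_ne_zero.mpr Fintype.card_ne_zero

lemma card_sub_one_ne_zero : (Fintype.card F - 1 : ℂ) ≠ 0 := by
  have : (Fintype.card F : ℂ) ≠ 1 := by exact_mod_cast (Fintype.one_lt_card (α := F)).ne'
  exact sub_ne_zero.mpr this


lemma gaussSum_one (hψ : ψ.IsPrimitive) : gaussSum (1 : MulChar F ℂ) ψ = -1 :=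
  by
  have := hψ one_ne_zero
  rw [AddChar.mulShift_one] at this
  exact gaussSum_one_left this

lemma sum_mulChar_mul_addChar_mul (χ : MulChar F ℂ) {t : F} (ht : t ≠ 0) :
    ∑ y, χ y * ψ (y * t) = χ⁻¹ t * gaussSum χ ψ := by
  have := gaussSum_mulShift_eq χ ψ (Units.mk0 t ht)
  simp only [gaussSum, AddChar.mulShift_apply, Units.val_mk0] at this ⊢
  rw [← this]
  exact sum_congr rfl fun y _ => by rw [mul_comm t]

/-- For nontrivial χ both sides vanish at t = 0, so no condition on t is needed. This matters for χ
= φ, where t runs over values of a form that may be zero. -/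
lemma sum_mulChar_mul_addChar_mul' {χ : MulChar F ℂ} (hχ : χ ≠ 1) (t : F) :
    ∑ y, χ y * ψ (y * t) = χ⁻¹ t * gaussSum χ ψ := by
  by_cases ht : t = 0
  · subst ht
    simpa [MulChar.sum_eq_zero_of_ne_one hχ, mulChar_inv_apply] using Or.inl χ.map_zero
  · exact sum_mulChar_mul_addChar_mul χ ht

lemma gaussSum_inv_addChar (χ : MulChar F ℂ) : gaussSum χ ψ⁻¹ = χ (-1) * gaussSum χ ψ := by
  rw [← mul_gaussSum_inv_eq_gaussSum χ ψ, ← mul_assoc, mulChar_neg_one_mul_self, one_mul]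

lemma gaussSum_mul_gaussSum_inv (hψ : ψ.IsPrimitive) {χ : MulChar F ℂ} (hχ : χ ≠ 1) :
    gaussSum χ ψ * gaussSum χ⁻¹ ψ = χ (-1) * Fintype.card F := by
  have h := gaussSum_mul_gaussSum_eq_card hχ hψ
  rw [gaussSum_inv_addChar, MulChar.inv_apply', inv_neg_one] at h
  linear_combination χ (-1) * h - gaussSum χ ψ * gaussSum χ⁻¹ ψ * mulChar_neg_one_mul_self χ

lemma gaussSum_ne_zero (hψ : ψ.IsPrimitive) (χ : MulChar F ℂ) : gaussSum χ ψ ≠ 0 := by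
  by_cases hχ : χ = 1
  · rw [hχ, gaussSum_one hψ]; norm_num
  · exact gaussSum_ne_zero_of_nontrivial card_ne_zero' hχ hψ

lemma star_gaussSum (χ : MulChar F ℂ) :
    star (gaussSum χ ψ) = χ (-1) * gaussSum χ⁻¹ ψ := by
  rw [star_gaussSum_eq, gaussSum_inv_addChar, MulChar.inv_apply', inv_neg_one]

lemma gaussSum_mul_star (hψ : ψ.IsPrimitive) {χ : MulChar F ℂ} (hχ : χ ≠ 1) :
    gaussSum χ ψ * star (gaussSum χ ψ) = Fintype.card F := by
  rw [star_gaussSum, mul_left_comm, gaussSum_mul_gaussSum_inv hψ hχ, ← mul_assoc,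
    mulChar_neg_one_mul_self, one_mul]

/-- Multiplying by the Gauss sum of the inverse character, instead of dividing by that of χθ, makes
one formula cover χθ = 1 as well. -/
lemma card_mul_jacobiSum (hψ : ψ.IsPrimitive) {χ θ : MulChar F ℂ} (h : χ ≠ 1 ∨ θ ≠ 1) :
    Fintype.card F * jacobiSum χ θ =
      (χ * θ) (-1) * gaussSum χ ψ * gaussSum θ ψ * gaussSum (χ * θ)⁻¹ ψ := by
  by_cases hχθ : χ * θ = 1
  · have hθ : θ = χ⁻¹ := eq_inv_of_mul_eq_one_right hχθ
    have hχ : χ ≠ 1 := by rintro rfl; simp_all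
    rw [hχθ, hθ, jacobiSum_nontrivial_inv hχ, inv_one, gaussSum_one hψ,
      MulChar.one_apply (isUnit_one.neg)]
    linear_combination gaussSum_mul_gaussSum_inv hψ hχ
  · have h1 := jacobiSum_mul_nontrivial hχθ ψ
    have h2 := gaussSum_mul_gaussSum_inv hψ hχθ
    rw [mul_assoc _ (gaussSum χ ψ), ← h1]
    linear_combination (-(χ * θ) (-1) * jacobiSum χ θ) * h2
      - jacobiSum χ θ * Fintype.card F * mulChar_neg_one_mul_self (χ * θ)

/-! ### The Hasse–Davenport formula for cubic characters. -/

/-- The nodal cubic `u + v + w = 3`, `u v w = 1` has at least `q - 3` points. -/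
lemma card_nodal_cubic :
    Fintype.card F ≤ #{x : F × F | x.1 ^ 2 * x.2 + x.1 * x.2 ^ 2 + 1 = 3 * x.1 * x.2} + 3 := by
  -- The roots of t² + t + 1 are the parameters of the two tangents at the node (1, 1).
  obtain ⟨r, hr⟩ : ∃ r : F, ∀ t : F, t ^ 2 + t + 1 = 0 → t = r ∨ t = -1 - r := by
    by_cases h : ∃ r : F, r ^ 2 + r + 1 = 0
    · obtain ⟨r, hr⟩ := h
      refine ⟨r, fun t ht => ?_⟩
      have : (t - r) * (t - (-1 - r)) = 0 := by linear_combination ht - hr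
      exact (mul_eq_zero.mp this).imp sub_eq_zero.mp sub_eq_zero.mp
    · exact ⟨0, fun t ht => (h ⟨t, ht⟩).elim⟩
  set T : Finset F := univ \ {0, -1, r, -1 - r} with hT
  have hTcard : Fintype.card F ≤ #T + 4 := by
    have h1 := card_sdiff_add_card_inter (univ : Finset F) {0, -1, r, -1 - r}
    have h2 : #({0, -1, r, -1 - r} : Finset F) ≤ 4 := card_le_four
    rw [univ_inter, card_univ, ← hT] at h1
    omega
  have hTmem : ∀ t ∈ T, t ≠ 0 ∧ 1 + t ≠ 0 ∧ t ^ 2 + t + 1 ≠ 0 := by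
    intro t ht
    simp only [hT, mem_sdiff, mem_univ, true_and, mem_insert, mem_singleton, not_or] at ht
    refine ⟨ht.1, fun h => ht.2.1 (by linear_combination h), fun h => ?_⟩
    rcases hr t h with h | h
    exacts [ht.2.2.1 h, ht.2.2.2 h]
  -- The line through the node (1, 1) of slope 1/t meets the cubic in this one further point.
  -- Discarding at most four parameters and adding the node leaves at least q - 3 points.
  let f : F → F × F := fun t => (-t ^ 2 / (1 + t), -1 / (t * (1 + t)))
  have hinj : Set.InjOn f T := by
    intro t ht s hs hts
    obtain ⟨t0, t1, t2⟩ := hTmem t ht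
    obtain ⟨s0, s1, s2⟩ := hTmem s hs
    simp only [f, Prod.mk.injEq] at hts
    obtain ⟨e1, e2⟩ := hts
    rw [div_eq_div_iff t1 s1] at e1
    rw [div_eq_div_iff (mul_ne_zero t0 t1) (mul_ne_zero s0 s1)] at e2
    by_contra hne
    have hne' := sub_ne_zero.mpr hne
    -- Each coordinate equation is divisible by t - s; two distinct parameters can share a point
    -- only at the node.
    have a1 : t + s + t * s = 0 := mul_left_cancel₀ hne' (by linear_combination -e1)
    have a2 : 1 + t + s = 0 := mul_left_cancel₀ hne' (by linear_combination e2)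
    exact t2 (by linear_combination (t + 1) * a2 - a1)
  have hsub : insert (1, 1) (T.image f) ⊆
      ({x : F × F | x.1 ^ 2 * x.2 + x.1 * x.2 ^ 2 + 1 = 3 * x.1 * x.2} : Finset (F × F)) := by
    intro x hx
    rw [mem_insert, mem_image] at hx
    rw [mem_filter]
    refine ⟨mem_univ _, ?_⟩
    rcases hx with rfl | ⟨t, ht, rfl⟩
    · norm_num
    · obtain ⟨t0, t1, t2⟩ := hTmem t ht
      simp only [f]
      field_simp
      ring
  have hnot : ((1, 1) : F × F) ∉ T.image f := by
    rw [mem_image]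
    rintro ⟨t, ht, hf⟩
    obtain ⟨t0, t1, t2⟩ := hTmem t ht
    simp only [f, Prod.mk.injEq] at hf
    have := (div_eq_one_iff_eq t1).mp hf.1
    exact t2 (by linear_combination -this)
  have := card_le_card hsub
  rw [card_insert_of_notMem hnot, card_image_of_injOn hinj] at this
  omega

/-- In the rational parametrization of the curve v/w = t³, so a cubic character cannot distinguish v
from w. -/
lemma cubic_char_nodal_cubic {η : MulChar F ℂ} (hη : η ^ 3 = 1) {v w : F}
    (h : v ^ 2 * w + v * w ^ 2 + 1 = 3 * v * w) : η v * η⁻¹ w = 1 := by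
  have hv : v ≠ 0 := by rintro rfl; simp at h
  have hw : w ≠ 0 := by rintro rfl; simp at h
  rw [mulChar_inv_apply]
  suffices ∃ t, t ≠ 0 ∧ v = w * t ^ 3 by
    obtain ⟨t, ht, rfl⟩ := this
    rw [map_mul, map_pow, ← mulChar_pow_apply η three_ne_zero, hη,
      MulChar.one_apply (IsUnit.mk0 t ht), mul_one, mul_inv_cancel₀ (mulChar_ne_zero η hw)]
  -- On the curve, vw = 1 forces v = w = 1, the node; elsewhere the parameter is recovered as v(1 -
  -- w)/(vw - 1).
  by_cases hvw : v * w = 1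
  · have hs : v + w = 2 := by linear_combination h - (v + w - 3) * hvw
    have h2 : (v - w) ^ 2 = 0 := by linear_combination (v + w + 2) * hs - 4 * hvw
    have := sub_eq_zero.mp (pow_eq_zero_iff two_ne_zero |>.mp h2)
    exact ⟨1, one_ne_zero, by rw [this]; ring⟩
  · have hd := sub_ne_zero.mpr hvw
    have e : v * (v * w - 1) ^ 3 = w * (v * (1 - w)) ^ 3 := by
      linear_combination v * (v * w ^ 2 - 1) * h
    refine ⟨v * (1 - w) / (v * w - 1), fun h0 => ?_, ?_⟩
    · rw [div_eq_zero_iff, or_iff_left hd] at h0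
      rw [h0] at e
      exact mul_ne_zero hv (pow_ne_zero 3 hd) (by rw [e]; ring)
    · rw [div_pow, ← mul_div_assoc, eq_div_iff (pow_ne_zero 3 hd), e]


/-- Scaling the three Gauss sum variables u, v, w by z gathers the dependence on χ into χ(uvw);
orthogonality then imposes uvw = 1. -/
lemma sum_gaussSum_cubic_mul {η : MulChar F ℂ} {z : F} (hz : z ≠ 0) :
    ∑ χ : MulChar F ℂ, gaussSum χ ψ * gaussSum (χ * η) ψ * gaussSum (χ * η⁻¹) ψ *
        (χ⁻¹ (z ^ 3) * ψ (-3 * z)) =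
      (Fintype.card F - 1) *
        ∑ v, ∑ w, η v * η⁻¹ w * ψ (z * ((v * w)⁻¹ + v + w - 3)) := by
  have key : ∀ χ : MulChar F ℂ, gaussSum χ ψ * gaussSum (χ * η) ψ * gaussSum (χ * η⁻¹) ψ *
        (χ⁻¹ (z ^ 3) * ψ (-3 * z)) =
      ∑ v, ∑ w, ∑ u, χ (u * (v * w)) * (η v * η⁻¹ w * ψ (z * (u + v + w - 3))) := by
    intro χ
    have e1 := sum_mulChar_mul_addChar_mul (ψ := ψ) χ hz
    have e2 := sum_mulChar_mul_addChar_mul (ψ := ψ) (χ * η) hz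
    have e3 := sum_mulChar_mul_addChar_mul (ψ := ψ) (χ * η⁻¹) hz
    have hη0 := mulChar_ne_zero η hz
    calc _ = ((χ * η)⁻¹ z * gaussSum (χ * η) ψ) * (((χ * η⁻¹)⁻¹ z * gaussSum (χ * η⁻¹) ψ) *
          ((χ⁻¹ z * gaussSum χ ψ) * ψ (-3 * z))) := by
            simp only [mulChar_inv_apply, MulChar.mul_apply, map_pow]
            field_simp
      _ = ∑ v, ∑ w, ∑ u, (χ u * ψ (u * z)) * ((χ * η) v * ψ (v * z)) *
            ((χ * η⁻¹) w * ψ (w * z)) * ψ (-3 * z) := by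
            rw [← e1, ← e2, ← e3]
            simp only [sum_mul]
            simp only [mul_sum]
            refine sum_congr rfl fun v _ => ?_
            refine sum_congr rfl fun w _ => ?_
            refine sum_congr rfl fun u _ => ?_
            ring
      _ = _ := by
            refine sum_congr rfl fun v _ => ?_
            refine sum_congr rfl fun w _ => ?_
            refine sum_congr rfl fun u _ => ?_
            rw [show z * (u + v + w - 3) = u * z + v * z + w * z + -3 * z by ring]
            simp only [AddChar.map_add_eq_mul, MulChar.mul_apply, map_mul]
            ring
  simp only [key]
  rw [sum_comm, mul_sum]
  refine sum_congr rfl fun v _ => ?_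
  rw [sum_comm, mul_sum]
  refine sum_congr rfl fun w _ => ?_
  rw [sum_comm]
  by_cases hv : v = 0
  · simp [hv, MulChar.map_zero]
  by_cases hw : w = 0
  · simp [hw, MulChar.map_zero]
  have hvw := mul_ne_zero hv hw
  simp only [← sum_mul, sum_mulChar_apply, ite_mul, zero_mul, ← eq_mul_inv_iff_mul_eq₀ hvw, one_mul]
  rw [sum_ite_eq' univ, if_pos (mem_univ _)]

/-- The conjugated factor supplies a further variable z; summing ψ over z detects u + v + w = 3 on
uvw = 1. On that curve the cubic character weight is 1, so the cross term is a plain point count. -/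
lemma sum_gaussSum_cubic_cross (hψ : ψ.IsPrimitive) {η : MulChar F ℂ} (hη3 : η ^ 3 = 1)
    (hη : η ≠ 1) (h3 : (3 : F) ≠ 0) :
    ∑ χ : MulChar F ℂ, gaussSum χ ψ * gaussSum (χ * η) ψ * gaussSum (χ * η⁻¹) ψ *
        star (Fintype.card F * χ⁻¹ 27 * gaussSum (χ ^ 3) ψ) =
      Fintype.card F ^ 2 * (Fintype.card F - 1) *
        #{x : F × F | x.1 ^ 2 * x.2 + x.1 * x.2 ^ 2 + 1 = 3 * x.1 * x.2} := by
  have hm3 : (-3 : F) ≠ 0 := neg_ne_zero.mpr h3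
  have hR : ∀ χ : MulChar F ℂ, star (Fintype.card F * χ⁻¹ 27 * gaussSum (χ ^ 3) ψ) =
      Fintype.card F * ∑ z, χ⁻¹ (z ^ 3) * ψ (-3 * z) := by
    intro χ
    rw [star_mul', star_mul', star_gaussSum, star_natCast, MulChar.star_apply', inv_inv, mul_assoc]
    congr 1
    -- The dilation by -3 produces χ(-3)³ = χ(-1)χ(27), which cancels χ(27) and the sign from
    -- conjugation.
    rw [gaussSum, mul_sum, mul_sum, ← sum_comp_mul_left _ hm3]
    refine sum_congr rfl fun z _ => ?_
    have h27 : χ 27 ≠ 0 := mulChar_ne_zero χ (by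
      rw [show (27 : F) = 3 ^ 3 by norm_num]; exact pow_ne_zero 3 h3)
    have e : χ (-3) ^ 3 = χ (-1) * χ 27 := by rw [← map_pow, ← map_mul]; norm_num
    have e1 : χ (-1) ^ 2 = 1 := by rw [sq, mulChar_neg_one_mul_self]
    have e2 : χ (-1) ≠ 0 := mulChar_ne_zero χ (by simp)
    simp only [mulChar_inv_apply, mulChar_pow_apply _ three_ne_zero, map_mul, map_pow, e]
    field_simp
    linear_combination ψ (-(3 * z)) * (χ z)⁻¹ ^ 3 * e1
  simp only [hR, mul_left_comm _ (Fintype.card F : ℂ), ← mul_sum]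
  rw [sq, mul_assoc, mul_assoc]
  congr 1
  simp only [mul_sum]
  rw [sum_comm]
  -- At z = 0 both sides of the previous lemma's identity vanish, so z may range over the whole
  -- field.
  have hz0 : (Fintype.card F - 1) * ∑ v, ∑ w, η v * η⁻¹ w * ψ (0 * ((v * w)⁻¹ + v + w - 3)) = 0 := by
    simp [← mul_sum, ← sum_mul, MulChar.sum_eq_zero_of_ne_one hη]
  have hz : ∀ z : F, ∑ χ : MulChar F ℂ, gaussSum χ ψ * gaussSum (χ * η) ψ * gaussSum (χ * η⁻¹) ψ *
        (χ⁻¹ (z ^ 3) * ψ (-3 * z)) = (Fintype.card F - 1) *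
        ∑ v, ∑ w, η v * η⁻¹ w * ψ (z * ((v * w)⁻¹ + v + w - 3)) := by
    intro z
    by_cases h : z = 0
    · subst h
      rw [hz0]
      simp [MulChar.map_zero]
    · exact sum_gaussSum_cubic_mul h
  rw [sum_congr rfl fun z _ => hz z, ← mul_sum, mul_left_comm]
  congr 1
  rw [sum_comm, card_filter, Fintype.sum_prod_type, Nat.cast_sum, mul_sum]
  refine sum_congr rfl fun v _ => ?_
  rw [sum_comm, Nat.cast_sum, mul_sum]
  refine sum_congr rfl fun w _ => ?_
  rw [← mul_sum, AddChar.sum_mulShift _ hψ]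
  by_cases hv : v = 0
  · simp [hv, MulChar.map_zero]
  by_cases hw : w = 0
  · simp [hw, MulChar.map_zero]
  have hiff : (v * w)⁻¹ + v + w - 3 = 0 ↔ v ^ 2 * w + v * w ^ 2 + 1 = 3 * v * w := by
    rw [← sub_eq_zero (a := v ^ 2 * w + v * w ^ 2 + 1),
      show (v * w)⁻¹ + v + w - 3 = (v ^ 2 * w + v * w ^ 2 + 1 - 3 * v * w) / (v * w) by
        field_simp; ring, div_eq_zero_iff, or_iff_left (mul_ne_zero hv hw)]
  by_cases h : v ^ 2 * w + v * w ^ 2 + 1 = 3 * v * w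
  · simp only [hiff, h, if_true, cubic_char_nodal_cubic hη3 h]
    simp
  · simp only [hiff, h, if_false]
    simp

lemma normSq_gaussSum (hψ : ψ.IsPrimitive) {χ : MulChar F ℂ} (hχ : χ ≠ 1) :
    Complex.normSq (gaussSum χ ψ) = Fintype.card F := by
  have := gaussSum_mul_star hψ hχ
  rw [← starRingEnd_apply, Complex.mul_conj] at this
  exact_mod_cast this

/-- The Hasse–Davenport product formula for characters of order three. -/
theorem gaussSum_mul_gaussSum_mul_gaussSum (hψ : ψ.IsPrimitive) {η : MulChar F ℂ}
    (hη3 : η ^ 3 = 1) (hη : η ≠ 1) (h3 : (3 : F) ≠ 0) (χ : MulChar F ℂ) :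
    gaussSum χ ψ * gaussSum (χ * η) ψ * gaussSum (χ * η⁻¹) ψ =
      Fintype.card F * χ⁻¹ 27 * gaussSum (χ ^ 3) ψ := by
  classical
  obtain ⟨q, hq⟩ : ∃ q : ℝ, q = (Fintype.card F : ℝ) := ⟨_, rfl⟩
  have hq1 : 1 ≤ q := by rw [hq]; exact_mod_cast Fintype.card_pos (α := F)
  let P : MulChar F ℂ → ℂ := fun χ => gaussSum χ ψ * gaussSum (χ * η) ψ * gaussSum (χ * η⁻¹) ψ
  let R : MulChar F ℂ → ℂ := fun χ => Fintype.card F * χ⁻¹ 27 * gaussSum (χ ^ 3) ψ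
  let s : Finset (MulChar F ℂ) := {1, η, η⁻¹}
  have hηi : η ≠ η⁻¹ := fun h => hη (by
    have h2 : η ^ 2 = 1 := by rw [sq]; nth_rw 2 [h]; exact mul_inv_cancel η
    rwa [pow_succ, h2, one_mul] at hη3)
  have hs : #s = 3 := card_eq_three.mpr ⟨1, η, η⁻¹, hη.symm, (inv_ne_one.mpr hη).symm, hηi, rfl⟩
  have hmem : ∀ χ, χ ∉ s → χ ≠ 1 ∧ χ * η ≠ 1 ∧ χ * η⁻¹ ≠ 1 := by
    intro χ hχ
    simp only [s, mem_insert, mem_singleton, not_or] at hχ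
    exact ⟨hχ.1, fun h => hχ.2.2 (eq_inv_of_mul_eq_one_left h),
      fun h => hχ.2.1 (mul_inv_eq_one.mp h)⟩
  have hP : ∀ χ, Complex.normSq (P χ) = if χ ∈ s then q ^ 2 else q ^ 3 := by
    intro χ
    split_ifs with h
    · have hη2 : η * η ≠ 1 := fun h => hηi (eq_inv_of_mul_eq_one_left h)
      have hη2' : η⁻¹ * η⁻¹ ≠ 1 := fun h => hηi (by rw [← inv_eq_of_mul_eq_one_left h, inv_inv])
      simp only [s, mem_insert, mem_singleton] at h
      rcases h with rfl | rfl | rfl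
      · simp only [P, map_mul, one_mul, gaussSum_one hψ, normSq_gaussSum hψ hη,
          normSq_gaussSum hψ (inv_ne_one.mpr hη)]
        simp [sq, hq]
      · simp only [P, map_mul, mul_inv_cancel, gaussSum_one hψ, normSq_gaussSum hψ hη,
          normSq_gaussSum hψ hη2]
        simp [sq, hq]
      · simp only [P, map_mul, inv_mul_cancel, gaussSum_one hψ,
          normSq_gaussSum hψ (inv_ne_one.mpr hη), normSq_gaussSum hψ hη2']
        simp [sq, hq]
    · obtain ⟨a, b, c⟩ := hmem χ h
      simp only [P, map_mul, normSq_gaussSum hψ a, normSq_gaussSum hψ b, normSq_gaussSum hψ c, ← hq]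
      ring
  -- An upper bound suffices, so there is no need to know that `s` contains every character with
  -- trivial cube.
  have hR : ∀ χ, Complex.normSq (R χ) ≤ if χ ∈ s then q ^ 2 else q ^ 3 := by
    intro χ
    have h27 : Complex.normSq (χ⁻¹ 27) = 1 := by
      have h0 : (27 : F) ≠ 0 := by
        rw [show (27 : F) = 3 ^ 3 by norm_num]; exact pow_ne_zero 3 h3
      have : χ⁻¹ 27 * star (χ⁻¹ 27) = 1 := by
        rw [MulChar.star_apply', inv_inv, mulChar_inv_apply, inv_mul_cancel₀ (mulChar_ne_zero χ h0)]
      rw [← starRingEnd_apply, Complex.mul_conj] at this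
      exact_mod_cast this
    simp only [R, map_mul, h27, Complex.normSq_natCast, mul_one]
    by_cases h1 : χ ^ 3 = 1
    · rw [h1, gaussSum_one hψ]
      split_ifs
      · simp [hq, sq]
      · rw [← hq]
        simp only [map_one, Complex.normSq_neg]
        nlinarith
    · have : χ ∉ s := by
        intro h
        simp only [s, mem_insert, mem_singleton] at h
        rcases h with rfl | rfl | rfl
        · exact h1 (one_pow 3)
        · exact h1 hη3
        · exact h1 (by rw [inv_pow, hη3, inv_one])
      rw [if_neg this, normSq_gaussSum hψ h1, ← hq]
      exact le_of_eq (by ring)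
  -- This value factors as q²(q - 1)(q - 3), exactly the lower bound for the cross term; hence the
  -- mean square of P - R is at most 0.
  have hsum : ∑ χ : MulChar F ℂ, (if χ ∈ s then q ^ 2 else q ^ 3) = q ^ 4 - 4 * q ^ 3 + 3 * q ^ 2 := by
    have hc : (Fintype.card (MulChar F ℂ) : ℝ) = q - 1 := by
      rw [hq]
      simpa using congrArg Complex.re (card_mulChar (F := F))
    have : ∀ χ, (if χ ∈ s then q ^ 2 else q ^ 3) = q ^ 3 - if χ ∈ s then q ^ 3 - q ^ 2 else 0 := by
      intro χ; split_ifs <;> ring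
    simp only [this, sum_sub_distrib, sum_const, card_univ, nsmul_eq_mul, hc, sum_ite_mem, univ_inter,
      hs]
    push_cast
    ring
  have hcross : ∑ χ : MulChar F ℂ, (P χ * (starRingEnd ℂ) (R χ)).re ≥ q ^ 2 * (q - 1) * (q - 3) := by
    have h1 := sum_gaussSum_cubic_cross hψ hη3 hη h3
    have h2 : q ≤ #{x : F × F | x.1 ^ 2 * x.2 + x.1 * x.2 ^ 2 + 1 = 3 * x.1 * x.2} + 3 := by
      rw [hq]
      exact_mod_cast card_nodal_cubic (F := F)
    rw [← Complex.re_sum]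
    have h4 : ∑ χ : MulChar F ℂ, P χ * (starRingEnd ℂ) (R χ) =
      ((q ^ 2 * (q - 1) *
        #{x : F × F | x.1 ^ 2 * x.2 + x.1 * x.2 ^ 2 + 1 = 3 * x.1 * x.2} : ℝ) : ℂ) := by
      rw [hq]
      push_cast
      exact h1
    rw [h4, Complex.ofReal_re]
    exact mul_le_mul_of_nonneg_left (by linarith) (mul_nonneg (sq_nonneg q) (by linarith))
  have hle : ∑ χ : MulChar F ℂ, Complex.normSq (P χ - R χ) ≤ 0 := by
    simp only [Complex.normSq_sub, sum_sub_distrib, sum_add_distrib, ← mul_sum]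
    have h1 := sum_le_sum fun χ (_ : χ ∈ univ) => hR χ
    rw [hsum] at h1
    simp only [hP, hsum]
    nlinarith
  have h0 := (sum_eq_zero_iff_of_nonneg fun χ _ => Complex.normSq_nonneg (P χ - R χ)).mp
    (le_antisymm hle (sum_nonneg fun χ _ => Complex.normSq_nonneg _)) χ (mem_univ χ)
  exact sub_eq_zero.mp (Complex.normSq_eq_zero.mp h0)

/-! ### The quadratic character on values of quadratic forms. -/

lemma ringChar_ne_two (h2 : (2 : F) ≠ 0) : ringChar F ≠ 2 := fun h =>
  h2 (by have := ringChar.Nat.cast_ringChar (R := F); rw [h] at this; exact_mod_cast this)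

lemma quadChar_apply (x : F) : quadChar F x = (quadraticChar F x : ℂ) := rfl

lemma quadChar_ne_one (h2 : (2 : F) ≠ 0) : quadChar F ≠ 1 :=
  (MulChar.ringHomComp_ne_one_iff (Int.cast_injective (α := ℂ))).mpr
    (quadraticChar_ne_one (ringChar_ne_two h2))

lemma quadChar_mul_self {x : F} (hx : x ≠ 0) : quadChar F x * quadChar F x = 1 := by
  rw [quadChar_apply, ← sq]
  exact_mod_cast quadraticChar_sq_one hx

lemma quadChar_sq {x : F} (hx : x ≠ 0) : quadChar F (x ^ 2) = 1 := by
  rw [sq, map_mul, quadChar_mul_self hx]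

lemma quadChar_mul_quadChar : quadChar F * quadChar F = 1 := by
  ext x
  rw [MulChar.mul_apply, quadChar_mul_self x.ne_zero, MulChar.one_apply x.isUnit]

lemma quadChar_inv : (quadChar F)⁻¹ = quadChar F :=
  inv_eq_of_mul_eq_one_left quadChar_mul_quadChar

/-- The quadratic character counts square roots. -/
lemma sum_ite_sq_eq (h2 : (2 : F) ≠ 0) (D : F) :
    ∑ s : F, (if s ^ 2 = D then (1 : ℂ) else 0) = 1 + quadChar F D := by
  have h := quadraticChar_card_sqrts (ringChar_ne_two h2) D
  rw [Set.toFinset_card] at h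
  rw [quadChar_apply, sum_boole, add_comm]
  have h' : ((Fintype.card {x : F | x ^ 2 = D} : ℤ) : ℂ) = ((quadraticChar F D + 1 : ℤ) : ℂ) := by
    rw [h]
  rw [Fintype.card_of_subtype (univ.filter fun x : F => x ^ 2 = D) (by simp)] at h'
  exact_mod_cast h'

lemma sum_comp_affine {M : Type*} [AddCommMonoid M] (f : F → M) {c : F} (hc : c ≠ 0) (d : F) :
    ∑ x, f (c * x + d) = ∑ x, f x := by
  rw [sum_comp_mul_left (fun x => f (x + d)) hc]
  exact Fintype.sum_equiv (Equiv.addRight d) _ _ fun _ => rfl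

/-- Grouping s by its square brings in the weight 1 + φ(t); for D ≠ 0 the remaining sum is, up to
φ(-1), the Jacobi sum of φ and its inverse. -/
lemma sum_quadChar_sq_sub (h2 : (2 : F) ≠ 0) (D : F) :
    ∑ s : F, quadChar F (s ^ 2 - D) = -1 + if D = 0 then (Fintype.card F : ℂ) else 0 := by
  have hφ := quadChar_ne_one h2
  have h1 : ∀ s : F, quadChar F (s ^ 2 - D) =
      ∑ t : F, (if s ^ 2 = t then (1 : ℂ) else 0) * quadChar F (t - D) := by
    intro s
    simp
  simp only [h1]
  rw [sum_comm]
  simp only [← sum_mul, sum_ite_sq_eq h2, add_mul, sum_add_distrib, one_mul]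
  rw [Fintype.sum_equiv (Equiv.subRight D) (fun t => quadChar F (t - D)) (quadChar F)
    (fun _ => rfl), MulChar.sum_eq_zero_of_ne_one hφ, zero_add]
  split_ifs with hD
  · subst hD
    have h3 : ∀ t : F, quadChar F t * quadChar F (t - 0) = 1 - if t = 0 then (1 : ℂ) else 0 := by
      intro t
      split_ifs with ht
      · simp [ht, MulChar.map_zero]
      · rw [sub_zero, quadChar_mul_self ht, sub_zero]
    simp only [h3, sum_sub_distrib]
    simp
    ring
  · rw [← sum_comp_mul_left _ hD, add_zero]
    have h3 : ∀ t : F, quadChar F (D * t) * quadChar F (D * t - D) =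
        quadChar F (-1) * (quadChar F t * (quadChar F)⁻¹ (1 - t)) := by
      intro t
      rw [quadChar_inv, show D * t - D = D * (-1 * (1 - t)) by ring]
      simp only [map_mul]
      linear_combination (quadChar F t * quadChar F (-1) * quadChar F (1 - t)) *
        quadChar_mul_self hD
    simp only [h3, ← mul_sum]
    have h4 := jacobiSum_nontrivial_inv hφ
    rw [jacobiSum] at h4
    rw [h4, mul_neg, mulChar_neg_one_mul_self]

lemma sum_quadChar_quadratic (h2 : (2 : F) ≠ 0) {l : F} (hl : l ≠ 0) (m n : F) :
    ∑ b : F, quadChar F (l * b ^ 2 + m * b + n) =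
      quadChar F l * (-1 + if m ^ 2 - 4 * l * n = 0 then (Fintype.card F : ℂ) else 0) := by
  rw [← sum_quadChar_sq_sub h2, ← sum_comp_affine (fun s => quadChar F (s ^ 2 - (m ^ 2 - 4 * l * n)))
    (mul_ne_zero h2 hl) m, mul_sum]
  refine sum_congr rfl fun b _ => ?_
  rw [show (2 * l * b + m) ^ 2 - (m ^ 2 - 4 * l * n) = 2 ^ 2 * (l * (l * b ^ 2 + m * b + n)) by ring,
    map_mul, quadChar_sq h2, map_mul]
  linear_combination (-quadChar F (l * b ^ 2 + m * b + n)) * quadChar_mul_self hl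

lemma sum_ite_quadratic_eq_zero (h2 : (2 : F) ≠ 0) {l : F} (hl : l ≠ 0) (m n : F) :
    ∑ a : F, (if l * a ^ 2 + m * a + n = 0 then (1 : ℂ) else 0) =
      1 + quadChar F (m ^ 2 - 4 * l * n) := by
  rw [← sum_ite_sq_eq h2, ← sum_comp_affine
    (fun s => if s ^ 2 = m ^ 2 - 4 * l * n then (1 : ℂ) else 0) (mul_ne_zero h2 hl) m]
  refine sum_congr rfl fun a _ => if_congr ?_ rfl rfl
  have h4l : 4 * l ≠ 0 := mul_ne_zero (by rw [show (4 : F) = 2 * 2 by norm_num]; exact mul_ne_zero h2 h2) hl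
  constructor
  · intro h
    linear_combination 4 * l * h
  · intro h
    exact mul_left_cancel₀ h4l (by linear_combination h)

/-- The sum of the quadratic character over an affine chart of a ternary quadratic form. -/
lemma sum_quadChar_ternary (h2 : (2 : F) ≠ 0) (u v : F) {w : F} (hw : w ≠ 0) :
    ∑ a : F, ∑ b : F, quadChar F (a * b + a + b - u - v * a ^ 2 - w * b ^ 2) =
      Fintype.card F * quadChar F (-(1 + u + v + w - 4 * u * v * w))
        - (if 4 * v * w = 1 then Fintype.card F * quadChar F (-w) else 0)
        + if u = -1 / 2 ∧ v = -1 / 2 ∧ w = -1 / 2 then (Fintype.card F : ℂ) ^ 2 * quadChar F 2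
          else 0 := by
  have h4 : (4 : F) ≠ 0 := by rw [show (4 : F) = 2 * 2 by norm_num]; exact mul_ne_zero h2 h2
  -- The sum over b sees only whether the discriminant in b vanishes, and that discriminant is a
  -- polynomial of degree at most 2 in a. It remains to count its roots.
  have hinner : ∀ a : F, ∑ b : F, quadChar F (a * b + a + b - u - v * a ^ 2 - w * b ^ 2) =
      quadChar F (-w) * (-1 + Fintype.card F *
        if (1 - 4 * v * w) * a ^ 2 + (2 + 4 * w) * a + (1 - 4 * u * w) = 0 then (1 : ℂ) else 0) := by
    intro a
    rw [mul_ite, mul_one, mul_zero]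
    calc _ = ∑ b : F, quadChar F (-w * b ^ 2 + (a + 1) * b + (a - u - v * a ^ 2)) :=
          sum_congr rfl fun b _ => by congr 1; ring
      _ = _ := by
          rw [sum_quadChar_quadratic h2 (neg_ne_zero.mpr hw),
            show (a + 1) ^ 2 - 4 * -w * (a - u - v * a ^ 2) =
              (1 - 4 * v * w) * a ^ 2 + (2 + 4 * w) * a + (1 - 4 * u * w) by ring]
  simp only [hinner, ← mul_sum, sum_add_distrib, sum_const, card_univ, nsmul_eq_mul]
  by_cases hvw : 4 * v * w = 1
  · rw [if_pos hvw]
    have hv : v = 1 / (4 * w) := by field_simp; linear_combination hvw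
    -- Here the polynomial in a is a constant, and v = w = -1/2. The constant is zero exactly for u
    -- = -1/2, when the form is the rank-one (a + b + 1)²/2.
    by_cases hw2 : 2 + 4 * w = 0
    · have hw' : w = -1 / 2 := by
        field_simp
        exact mul_left_cancel₀ h2 (by linear_combination hw2)
      have hv' : v = -1 / 2 := by rw [hv, hw']; field_simp; norm_num
      have hdet : -(1 + u + v + w - 4 * u * v * w) = 0 := by rw [hv', hw']; field_simp; ring
      have hqw : quadChar F (-w) = quadChar F 2 := by
        have : quadChar F (-w) * quadChar F 2 = 1 := by
          rw [← map_mul, hw', show -(-1 / 2 : F) * 2 = 1 by field_simp, map_one]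
        linear_combination quadChar F 2 * this - quadChar F (-w) * quadChar_mul_self h2
      rw [hdet, MulChar.map_zero, hqw]
      have hl : ∀ a : F, (1 - 4 * v * w) * a ^ 2 + (2 + 4 * w) * a + (1 - 4 * u * w) =
          1 - 4 * u * w := by
        intro a; rw [hw2, hvw]; ring
      simp only [hl, sum_const, card_univ, nsmul_eq_mul]
      by_cases hu : u = -1 / 2
      · have c1 : u = -1 / 2 ∧ v = -1 / 2 ∧ w = -1 / 2 := ⟨hu, hv', hw'⟩
        have c2 : 1 - 4 * u * w = 0 := by rw [hu, hw']; field_simp; norm_num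
        rw [if_pos c1, if_pos c2]
        ring
      · have c1 : ¬ (u = -1 / 2 ∧ v = -1 / 2 ∧ w = -1 / 2) := fun h => hu h.1
        have c2 : ¬ 1 - 4 * u * w = 0 := fun h => hu (by
          field_simp
          rw [hw'] at h
          field_simp at h
          exact mul_left_cancel₀ h2 (by linear_combination h))
        rw [if_neg c1, if_neg c2]
        ring
    · have hw' : ¬ (u = -1 / 2 ∧ v = -1 / 2 ∧ w = -1 / 2) := by
        rintro ⟨-, -, h⟩
        exact hw2 (by rw [h]; field_simp; norm_num)
      rw [if_neg hw']
      have hone : ∑ a : F, (if (1 - 4 * v * w) * a ^ 2 + (2 + 4 * w) * a + (1 - 4 * u * w) = 0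
          then (1 : ℂ) else 0) = 1 := by
        rw [sum_eq_single (-(1 - 4 * u * w) / (2 + 4 * w)), if_pos]
        · rw [hvw]; field_simp; ring
        · intro a _ ha
          rw [if_neg]
          intro h
          apply ha
          rw [hvw] at h
          field_simp
          linear_combination h
        · simp
      have hdet : quadChar F (-(1 + u + v + w - 4 * u * v * w)) = quadChar F (-w) := by
        have e : -(1 + u + v + w - 4 * u * v * w) = -w * ((2 + 4 * w) / (4 * w)) ^ 2 := by
          rw [hv]; field_simp; ring
        rw [e, map_mul, quadChar_sq (div_ne_zero hw2 (mul_ne_zero h4 hw)), mul_one]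
      rw [hone, hdet]
      ring
  · have hw' : ¬ (u = -1 / 2 ∧ v = -1 / 2 ∧ w = -1 / 2) := by
      rintro ⟨-, h, h'⟩
      exact hvw (by rw [h, h']; field_simp; norm_num)
    rw [if_neg hvw, if_neg hw', sum_ite_quadratic_eq_zero h2
      (sub_ne_zero.mpr (Ne.symm hvw))]
    have e : (2 + 4 * w) ^ 2 - 4 * (1 - 4 * v * w) * (1 - 4 * u * w) =
        4 ^ 2 * (-w * -(1 + u + v + w - 4 * u * v * w)) := by ring
    rw [e, map_mul, quadChar_sq h4, map_mul]
    linear_combination (Fintype.card F * quadChar F (-(1 + u + v + w - 4 * u * v * w)) : ℂ) *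
      quadChar_mul_self (neg_ne_zero.mpr hw)

lemma sum_ite_punctured (h : F → F → ℂ) :
    ∑ a, ∑ b, (if a = 0 ∨ b = 0 then 0 else h a b) =
      ∑ a, ∑ b, h a b - ∑ b, h 0 b - ∑ a, h a 0 + h 0 0 := by
  have key : ∀ a b, (if a = 0 ∨ b = 0 then 0 else h a b) = h a b - (if a = 0 then h a b else 0) -
      (if b = 0 then h a b else 0) + if a = 0 then (if b = 0 then h a b else 0) else 0 := by
    intro a b
    by_cases ha : a = 0 <;> by_cases hb : b = 0 <;> simp [ha, hb]
  simp only [key, sum_add_distrib, sum_sub_distrib]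
  congr 1
  · congr 1
    · congr 1
      rw [sum_comm]
      simp
    · simp
  · simp [sum_ite_irrel]

/-- The sum of the quadratic character of a ternary quadratic form over the points of an affine
chart with nonzero coordinates. -/
noncomputable def ternarySum (u v w : F) : ℂ :=
  ∑ a : F, ∑ b : F, quadChar F (a * b) *
    quadChar F (1 + a⁻¹ + b⁻¹ - u * (a * b)⁻¹ - v * a * b⁻¹ - w * b * a⁻¹)

/-- Clearing denominators gives the ternary form on the affine chart with its two axes removed.
Inclusion–exclusion subtracts a one-variable quadratic sum for each axis and restores the origin. -/
lemma ternarySum_eq (h2 : (2 : F) ≠ 0) (u : F) {v w : F} (hv : v ≠ 0) (hw : w ≠ 0) :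
    ternarySum u v w =
      Fintype.card F * quadChar F (-(1 + u + v + w - 4 * u * v * w))
        - (if 4 * v * w = 1 then Fintype.card F * quadChar F (-w) else 0)
        + (if u = -1 / 2 ∧ v = -1 / 2 ∧ w = -1 / 2 then (Fintype.card F : ℂ) ^ 2 * quadChar F 2
          else 0)
        - quadChar F (-w) * (-1 + if 1 - 4 * u * w = 0 then (Fintype.card F : ℂ) else 0)
        - quadChar F (-v) * (-1 + if 1 - 4 * u * v = 0 then (Fintype.card F : ℂ) else 0)
        + quadChar F (-u) := by
  have h1 : ternarySum u v w = ∑ a : F, ∑ b : F, (if a = 0 ∨ b = 0 then 0 else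
      quadChar F (a * b + a + b - u - v * a ^ 2 - w * b ^ 2)) := by
    refine sum_congr rfl fun a _ => sum_congr rfl fun b _ => ?_
    split_ifs with h
    · rw [mul_eq_zero.mpr h, MulChar.map_zero, zero_mul]
    · rw [not_or] at h
      obtain ⟨ha, hb⟩ := h
      rw [← map_mul]
      congr 1
      field_simp
      ring
  rw [h1, sum_ite_punctured, sum_quadChar_ternary h2 u v hw]
  have ea : ∑ b : F, quadChar F (0 * b + 0 + b - u - v * 0 ^ 2 - w * b ^ 2) =
      quadChar F (-w) * (-1 + if 1 - 4 * u * w = 0 then (Fintype.card F : ℂ) else 0) := by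
    rw [show 1 - 4 * u * w = 1 ^ 2 - 4 * -w * -u by ring,
      ← sum_quadChar_quadratic h2 (neg_ne_zero.mpr hw)]
    exact sum_congr rfl fun b _ => by congr 1; ring
  have eb : ∑ a : F, quadChar F (a * 0 + a + 0 - u - v * a ^ 2 - w * 0 ^ 2) =
      quadChar F (-v) * (-1 + if 1 - 4 * u * v = 0 then (Fintype.card F : ℂ) else 0) := by
    rw [show 1 - 4 * u * v = 1 ^ 2 - 4 * -v * -u by ring,
      ← sum_quadChar_quadratic h2 (neg_ne_zero.mpr hv)]
    exact sum_congr rfl fun b _ => by congr 1; ring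
  rw [ea, eb]
  congr 2
  ring

/-- With u = x/(4vw), the conditions 4vw = 1, 4uw = 1, 4uv = 1 each fix one variable (the last two
as v = x and w = x). A complete sum of a nontrivial character remains, so these corrections vanish;
so does φ(-u), whose sum factors. Only the rank-one term survives. -/
lemma sum_mul_ternarySum (h2 : (2 : F) ≠ 0) {α β : MulChar F ℂ} (hα : α * quadChar F ≠ 1)
    (hβ : β * quadChar F ≠ 1) (hαβ : α⁻¹ * β * quadChar F ≠ 1) {x : F} (hx : x ≠ 0) :
    ∑ v, ∑ w, α v * β w * ternarySum (x / (4 * v * w)) v w =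
      Fintype.card F * quadChar F (-1) *
        ∑ v, ∑ w, α v * β w * quadChar F (1 - x + x / (4 * v * w) + v + w) +
      if x = -1 / 2 then Fintype.card F ^ 2 * quadChar F 2 * (α * β) (-1 / 2) else 0 := by
  have h4 : (4 : F) ≠ 0 := by rw [show (4 : F) = 2 * 2 by norm_num]; exact mul_ne_zero h2 h2
  set q : ℂ := (Fintype.card F : ℂ)
  have key : ∀ v w : F, α v * β w * ternarySum (x / (4 * v * w)) v w =
      q * quadChar F (-1) * (α v * β w * quadChar F (1 - x + x / (4 * v * w) + v + w))
      - q * quadChar F (-1) * (α 4)⁻¹ *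
          (if v = (4 * w)⁻¹ then (α⁻¹ * β * quadChar F) w else 0)
      + (if v = -1 / 2 then (if w = -1 / 2 then (if x = -1 / 2 then
          q ^ 2 * quadChar F 2 * (α * β) (-1 / 2) else 0) else 0) else 0)
      - quadChar F (-1) * (α v * (-1 + if v = x then q else 0) * (β * quadChar F) w)
      - quadChar F (-1) * ((α * quadChar F) v * (β w * (-1 + if w = x then q else 0)))
      + quadChar F (-x * 4) * ((α * quadChar F) v * (β * quadChar F) w) := by
    intro v w
    have hhalf : (-1 / 2 : F) ≠ 0 := div_ne_zero (by simp) h2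
    by_cases hv : v = 0
    · subst hv
      by_cases hw : w = 0
      · subst hw
        simp [MulChar.map_zero, hhalf.symm]
      · simp [MulChar.map_zero, hhalf.symm, hw, h4]
    by_cases hw : w = 0
    · subst hw
      simp [MulChar.map_zero, hhalf.symm]
    have h4v := mul_ne_zero h4 hv
    have h4w := mul_ne_zero h4 hw
    have h4vw := mul_ne_zero h4v hw
    rw [ternarySum_eq h2 _ hv hw]
    have e1 : -(1 + x / (4 * v * w) + v + w - 4 * (x / (4 * v * w)) * v * w) =
        -1 * (1 - x + x / (4 * v * w) + v + w) := by field_simp; ring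
    have c1 : 4 * v * w = 1 ↔ v = (4 * w)⁻¹ := by
      rw [← one_div, eq_div_iff h4w]
      constructor <;> intro h <;> linear_combination h
    have c2 : 1 - 4 * (x / (4 * v * w)) * w = 0 ↔ v = x := by
      rw [show 1 - 4 * (x / (4 * v * w)) * w = (v - x) / v by field_simp, div_eq_zero_iff,
        or_iff_left hv, sub_eq_zero]
    have c3 : 1 - 4 * (x / (4 * v * w)) * v = 0 ↔ w = x := by
      rw [show 1 - 4 * (x / (4 * v * w)) * v = (w - x) / w by field_simp, div_eq_zero_iff,
        or_iff_left hw, sub_eq_zero]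
    have c4 : (x / (4 * v * w) = -1 / 2 ∧ v = -1 / 2 ∧ w = -1 / 2) ↔
        v = -1 / 2 ∧ w = -1 / 2 ∧ x = -1 / 2 := by
      constructor
      · rintro ⟨h, rfl, rfl⟩
        refine ⟨rfl, rfl, ?_⟩
        rw [← h]; field_simp; norm_num
      · rintro ⟨rfl, rfl, rfl⟩
        refine ⟨?_, rfl, rfl⟩
        field_simp; norm_num
    have e2 : quadChar F (-(x / (4 * v * w))) = quadChar F (-x * 4) * quadChar F v * quadChar F w := by
      rw [← map_mul, ← map_mul, show -x * 4 * v * w = -(x / (4 * v * w)) * (4 * v * w) ^ 2 by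
        field_simp, map_mul, quadChar_sq h4vw, mul_one]
    rw [e1, map_mul, e2, ← neg_one_mul w, ← neg_one_mul v, map_mul _ (-1) w, map_mul _ (-1) v]
    simp only [c1, c2, c3, c4, ite_and, MulChar.mul_apply]
    have e3 : (if v = (4 * w)⁻¹ then q * (quadChar F (-1) * quadChar F w) else 0) * (α v * β w) =
        q * quadChar F (-1) * (α 4)⁻¹ *
          (if v = (4 * w)⁻¹ then α⁻¹ w * β w * quadChar F w else 0) := by
      split_ifs with h
      · rw [h, ← MulChar.inv_apply', mulChar_inv_apply, mulChar_inv_apply, map_mul, mul_inv]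
        ring
      · ring
    have e4 : (if v = -1 / 2 then (if w = -1 / 2 then (if x = -1 / 2 then
          q ^ 2 * quadChar F 2 else 0) else 0) else 0) * (α v * β w) =
        (if v = -1 / 2 then (if w = -1 / 2 then (if x = -1 / 2 then
          q ^ 2 * quadChar F 2 * (α (-1 / 2) * β (-1 / 2)) else 0) else 0) else 0) := by
      split_ifs with h h'
      · rw [h, h']
      all_goals ring
    linear_combination e4 - e3
  have z1 : ∑ v, ∑ w, (if v = (4 * w)⁻¹ then (α⁻¹ * β * quadChar F) w else 0) = 0 := by
    rw [sum_comm]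
    simpa using MulChar.sum_eq_zero_of_ne_one hαβ
  have z2 := MulChar.sum_eq_zero_of_ne_one hα
  have z3 := MulChar.sum_eq_zero_of_ne_one hβ
  simp only [key, sum_add_distrib, sum_sub_distrib, ← mul_sum, ← sum_mul, z1, z2, z3, mul_zero,
    zero_mul]
  simp

/-! ### The Gauss sum identity behind the transformation. -/

/-- Mellin inversion: orthogonality solves uvw = c for u, leaving a twisted Kloosterman sum in v and
w. -/
lemma sum_mulChar_mul_gaussSum_inv (α β : MulChar F ℂ) {c : F} (hc : c ≠ 0) :
    ∑ χ : MulChar F ℂ, χ c * (gaussSum χ⁻¹ ψ * gaussSum (α * χ⁻¹) ψ * gaussSum (β * χ⁻¹) ψ) =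
      (Fintype.card F - 1) * ∑ v, ∑ w, α v * β w * ψ (c / (v * w) + v + w) := by
  have key : ∀ χ : MulChar F ℂ,
      χ c * (gaussSum χ⁻¹ ψ * gaussSum (α * χ⁻¹) ψ * gaussSum (β * χ⁻¹) ψ) =
      ∑ v, ∑ w, ∑ u, χ (c * (u * (v * w))⁻¹) * (α v * β w * ψ (u + v + w)) := by
    intro χ
    calc _ = gaussSum (α * χ⁻¹) ψ * (gaussSum (β * χ⁻¹) ψ * (gaussSum χ⁻¹ ψ * χ c)) := by ring
      _ = _ := by
        simp only [gaussSum, sum_mul]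
        simp only [mul_sum]
        refine sum_congr rfl fun v _ => sum_congr rfl fun w _ => sum_congr rfl fun u _ => ?_
        rw [map_mul χ c, ← MulChar.inv_apply', map_mul, map_mul]
        simp only [AddChar.map_add_eq_mul, MulChar.mul_apply]
        ring
  simp only [key]
  rw [sum_comm, mul_sum]
  refine sum_congr rfl fun v _ => ?_
  rw [sum_comm, mul_sum]
  refine sum_congr rfl fun w _ => ?_
  rw [sum_comm]
  by_cases hv : v = 0
  · simp [hv, MulChar.map_zero]
  by_cases hw : w = 0
  · simp [hw, MulChar.map_zero]
  have hiff : ∀ u : F, c * (u * (v * w))⁻¹ = 1 ↔ u = c / (v * w) := by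
    intro u
    rw [eq_div_iff (mul_ne_zero hv hw)]
    by_cases hu : u = 0
    · simp [hu, hc.symm]
    · rw [← div_eq_mul_inv, div_eq_one_iff_eq (mul_ne_zero hu (mul_ne_zero hv hw)), eq_comm]
  simp only [← sum_mul, sum_mulChar_apply, ite_mul, zero_mul, hiff]
  rw [sum_ite_eq' univ, if_pos (mem_univ _)]

/-- The factor χ³(y) changes the Kloosterman parameter to xy³/4. Scaling v and w by y then makes the
argument of ψ linear in y and leaves only φ(y), so the y-sum is a quadratic Gauss sum. -/
lemma sum_gaussSum_mul_sum_addChar (h2 : (2 : F) ≠ 0) (α β : MulChar F ℂ) {x : F} (hx : x ≠ 0) :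
    ∑ χ : MulChar F ℂ, χ (x / 4) *
        (gaussSum χ⁻¹ ψ * gaussSum (α * χ⁻¹) ψ * gaussSum (β * χ⁻¹) ψ) *
        ∑ y, (quadChar F * α⁻¹ * β⁻¹ * χ ^ 3) y * ψ (y * (1 - x)) =
      (Fintype.card F - 1) * gaussSum (quadChar F) ψ *
        ∑ v, ∑ w, α v * β w * quadChar F (1 - x + x / (4 * v * w) + v + w) := by
  have h4 : (4 : F) ≠ 0 := by rw [show (4 : F) = 2 * 2 by norm_num]; exact mul_ne_zero h2 h2
  have hy : ∀ y : F, ∑ χ : MulChar F ℂ, χ (x / 4) *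
        (gaussSum χ⁻¹ ψ * gaussSum (α * χ⁻¹) ψ * gaussSum (β * χ⁻¹) ψ) *
        ((quadChar F * α⁻¹ * β⁻¹ * χ ^ 3) y * ψ (y * (1 - x))) =
      (Fintype.card F - 1) * ∑ v, ∑ w, α v * β w *
        (quadChar F y * ψ (y * (1 - x + x / (4 * v * w) + v + w))) := by
    intro y
    by_cases hy : y = 0
    · simp [hy, MulChar.map_zero]
    have hc : x / 4 * y ^ 3 ≠ 0 := mul_ne_zero (div_ne_zero hx h4) (pow_ne_zero 3 hy)
    calc _ = (quadChar F * α⁻¹ * β⁻¹) y * ψ (y * (1 - x)) * ∑ χ : MulChar F ℂ, χ (x / 4 * y ^ 3) *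
          (gaussSum χ⁻¹ ψ * gaussSum (α * χ⁻¹) ψ * gaussSum (β * χ⁻¹) ψ) := by
            rw [mul_sum]
            refine sum_congr rfl fun χ _ => ?_
            rw [MulChar.mul_apply _ (χ ^ 3), mulChar_pow_apply χ three_ne_zero, map_mul χ, map_pow]
            ring
      _ = (quadChar F * α⁻¹ * β⁻¹) y * ψ (y * (1 - x)) * ((Fintype.card F - 1) *
            ∑ v, ∑ w, α (y * v) * β (y * w) *
              ψ (x / 4 * y ^ 3 / (y * v * (y * w)) + y * v + y * w)) := by
            rw [sum_mulChar_mul_gaussSum_inv α β hc, ← sum_comp_mul_left _ hy]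
            congr 2
            refine sum_congr rfl fun v _ => ?_
            rw [← sum_comp_mul_left _ hy]
      _ = _ := by
            rw [mul_left_comm]
            congr 1
            simp only [mul_sum]
            refine sum_congr rfl fun v _ => sum_congr rfl fun w _ => ?_
            by_cases hv : v = 0
            · simp [hv, MulChar.map_zero]
            by_cases hw : w = 0
            · simp [hw, MulChar.map_zero]
            have e : y * (1 - x + x / (4 * v * w) + v + w) =
              y * (1 - x) + (x / 4 * y ^ 3 / (y * v * (y * w)) + y * v + y * w) := by
                field_simp; ring
            have hα := mulChar_ne_zero α hy
            have hβ := mulChar_ne_zero β hy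
            rw [e, AddChar.map_add_eq_mul ψ (y * (1 - x))]
            simp only [MulChar.mul_apply, mulChar_inv_apply, map_mul]
            field_simp
  calc _ = ∑ y, ∑ χ : MulChar F ℂ, χ (x / 4) *
        (gaussSum χ⁻¹ ψ * gaussSum (α * χ⁻¹) ψ * gaussSum (β * χ⁻¹) ψ) *
        ((quadChar F * α⁻¹ * β⁻¹ * χ ^ 3) y * ψ (y * (1 - x))) := by
          rw [sum_comm]
          exact sum_congr rfl fun χ _ => mul_sum ..
    _ = _ := by
          rw [sum_congr rfl fun y _ => hy y, ← mul_sum, mul_assoc]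
          congr 1
          rw [sum_comm, mul_sum]
          refine sum_congr rfl fun v _ => ?_
          rw [sum_comm, mul_sum]
          refine sum_congr rfl fun w _ => ?_
          rw [← mul_sum, sum_mulChar_mul_addChar_mul' (quadChar_ne_one h2), quadChar_inv]
          ring

/-- Bookkeeping for the substitution in `sum_six_gaussSum`: every value of α and β at d, a, b
cancels, and only quadratic characters remain there. -/
lemma mulChar_coeff (α β : MulChar F ℂ) {d a b : F} (hd : d ≠ 0) (ha : a ≠ 0) (hb : b ≠ 0)
    (v w : F) :
    (quadChar F * α⁻¹ * β⁻¹) d * (quadChar F * α * β⁻¹) (d * a⁻¹) *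
      (quadChar F * α⁻¹ * β) (d * b⁻¹) * (α (-d * a * b⁻¹ * v) * β (-d * b * a⁻¹ * w)) =
      (α * β) (-1) * (α v * β w * (quadChar F (a * b) * quadChar F d)) := by
  have qi : ∀ t : F, quadChar F t⁻¹ = quadChar F t := fun t => by
    rw [← MulChar.inv_apply', quadChar_inv]
  have αi : ∀ t : F, α t⁻¹ = (α t)⁻¹ := fun t => by
    rw [← MulChar.inv_apply', mulChar_inv_apply]
  have βi : ∀ t : F, β t⁻¹ = (β t)⁻¹ := fun t => by
    rw [← MulChar.inv_apply', mulChar_inv_apply]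
  have h1 := mulChar_ne_zero α hd
  have h3 := mulChar_ne_zero β hd
  have h5 := mulChar_ne_zero α ha
  have h6 := mulChar_ne_zero β ha
  have h7 := mulChar_ne_zero α hb
  have h8 := mulChar_ne_zero β hb
  have hq := quadChar_mul_self hd
  rw [show -d * a * b⁻¹ * v = -1 * d * a * b⁻¹ * v by ring,
    show -d * b * a⁻¹ * w = -1 * d * b * a⁻¹ * w by ring]
  simp only [MulChar.mul_apply, mulChar_inv_apply, map_mul, qi, αi, βi]
  generalize α d = αd at *
  generalize β d = βd at *
  generalize α a = αa at *
  generalize β a = βa at *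
  generalize α b = αb at *
  generalize β b = βb at *
  generalize quadChar F d = qd at *
  generalize quadChar F a = qa
  generalize quadChar F b = qb
  generalize α v = αv
  generalize β w = βw
  generalize α (-1) = α1
  generalize β (-1) = β1
  calc _ = (qd * qd) * qd * qa * qb * αv * βw * α1 * β1 *
        ((αd * αd⁻¹) * (αd * αd⁻¹) * (βd * βd⁻¹) * (βd * βd⁻¹) * (αa * αa⁻¹) * (αb * αb⁻¹) *
        (βb * βb⁻¹) * (βa * βa⁻¹)) := by
          simp only [inv_inv]
          ring
    _ = _ := by
          rw [hq, mul_inv_cancel₀ h1, mul_inv_cancel₀ h3, mul_inv_cancel₀ h5, mul_inv_cancel₀ h6,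
            mul_inv_cancel₀ h7, mul_inv_cancel₀ h8]
          ring

/-- Writing the variables of the last three Gauss sums as d, d/a, d/b makes the total argument of ψ
homogeneous in d after rescaling v and w. The d-sum is then a quadratic Gauss sum, and φ of the
ternary form remains. -/
lemma sum_six_gaussSum (h2 : (2 : F) ≠ 0) (α β : MulChar F ℂ) {x : F} (hx : x ≠ 0) :
    ∑ χ : MulChar F ℂ, χ (-x / 4) *
        (gaussSum χ⁻¹ ψ * gaussSum (α * χ⁻¹) ψ * gaussSum (β * χ⁻¹) ψ) *
        (gaussSum (quadChar F * α⁻¹ * β⁻¹ * χ) ψ * gaussSum (quadChar F * α * β⁻¹ * χ) ψ *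
          gaussSum (quadChar F * α⁻¹ * β * χ) ψ) =
      (Fintype.card F - 1) * (α * β) (-1) * gaussSum (quadChar F) ψ *
        ∑ v, ∑ w, α v * β w * ternarySum (x / (4 * v * w)) v w := by
  have h4 : (4 : F) ≠ 0 := by rw [show (4 : F) = 2 * 2 by norm_num]; exact mul_ne_zero h2 h2
  have hinv : ∀ (f : F → ℂ) {d : F}, d ≠ 0 → ∑ e, f e = ∑ a, f (d * a⁻¹) := by
    intro f d hd
    rw [← sum_comp_mul_left f hd]
    exact (Fintype.sum_equiv (Equiv.inv F) _ _ fun _ => rfl).symm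
  have hS : ∀ χ : MulChar F ℂ,
      gaussSum (quadChar F * α⁻¹ * β⁻¹ * χ) ψ * gaussSum (quadChar F * α * β⁻¹ * χ) ψ *
          gaussSum (quadChar F * α⁻¹ * β * χ) ψ =
      ∑ d, ∑ a, ∑ b, (quadChar F * α⁻¹ * β⁻¹ * χ) d * (quadChar F * α * β⁻¹ * χ) (d * a⁻¹) *
        (quadChar F * α⁻¹ * β * χ) (d * b⁻¹) * ψ (d + d * a⁻¹ + d * b⁻¹) := by
    intro χ
    rw [gaussSum, mul_assoc, sum_mul]
    refine sum_congr rfl fun d _ => ?_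
    by_cases hd : d = 0
    · simp [hd, MulChar.map_zero]
    rw [gaussSum, gaussSum, hinv _ hd, hinv (fun e => (quadChar F * α⁻¹ * β * χ) e * ψ e) hd,
      sum_mul_sum, mul_sum]
    refine sum_congr rfl fun a _ => ?_
    rw [mul_sum]
    refine sum_congr rfl fun b _ => ?_
    rw [AddChar.map_add_eq_mul, AddChar.map_add_eq_mul]
    ring
  have hd : ∀ d a b : F, ∑ χ : MulChar F ℂ, χ (-x / 4) *
        (gaussSum χ⁻¹ ψ * gaussSum (α * χ⁻¹) ψ * gaussSum (β * χ⁻¹) ψ) *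
        ((quadChar F * α⁻¹ * β⁻¹ * χ) d * (quadChar F * α * β⁻¹ * χ) (d * a⁻¹) *
        (quadChar F * α⁻¹ * β * χ) (d * b⁻¹) * ψ (d + d * a⁻¹ + d * b⁻¹)) =
      ∑ v, ∑ w, (Fintype.card F - 1) * (α * β) (-1) * (α v * β w * (quadChar F (a * b) *
        (quadChar F d * ψ (d * (1 + a⁻¹ + b⁻¹ - x / (4 * v * w) * (a * b)⁻¹ -
          v * a * b⁻¹ - w * b * a⁻¹))))) := by
    intro d a b
    by_cases hd : d = 0
    · simp [hd, MulChar.map_zero]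
    by_cases ha : a = 0
    · simp [ha, MulChar.map_zero]
    by_cases hb : b = 0
    · simp [hb, MulChar.map_zero]
    have hc : -x / 4 * (d ^ 3 * (a * b)⁻¹) ≠ 0 :=
      mul_ne_zero (div_ne_zero (neg_ne_zero.mpr hx) h4)
        (mul_ne_zero (pow_ne_zero 3 hd) (inv_ne_zero (mul_ne_zero ha hb)))
    -- The scalings by -da/b and -db/a have product d², so all terms become multiples of d with the
    -- coefficients of `ternarySum`.
    have hs : -d * a * b⁻¹ ≠ 0 :=
      mul_ne_zero (mul_ne_zero (neg_ne_zero.mpr hd) ha) (inv_ne_zero hb)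
    have ht : -d * b * a⁻¹ ≠ 0 :=
      mul_ne_zero (mul_ne_zero (neg_ne_zero.mpr hd) hb) (inv_ne_zero ha)
    calc _ = (quadChar F * α⁻¹ * β⁻¹) d * (quadChar F * α * β⁻¹) (d * a⁻¹) *
          (quadChar F * α⁻¹ * β) (d * b⁻¹) * ψ (d + d * a⁻¹ + d * b⁻¹) *
          ∑ χ : MulChar F ℂ, χ (-x / 4 * (d ^ 3 * (a * b)⁻¹)) *
          (gaussSum χ⁻¹ ψ * gaussSum (α * χ⁻¹) ψ * gaussSum (β * χ⁻¹) ψ) := by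
            rw [mul_sum]
            refine sum_congr rfl fun χ _ => ?_
            rw [show -x / 4 * (d ^ 3 * (a * b)⁻¹) = -x / 4 * (d * (d * a⁻¹) * (d * b⁻¹)) by
              field_simp, map_mul χ (-x / 4), map_mul χ (d * _), map_mul χ d]
            simp only [MulChar.mul_apply _ χ]
            ring
      _ = (quadChar F * α⁻¹ * β⁻¹) d * (quadChar F * α * β⁻¹) (d * a⁻¹) *
          (quadChar F * α⁻¹ * β) (d * b⁻¹) * ψ (d + d * a⁻¹ + d * b⁻¹) * ((Fintype.card F - 1) *
            ∑ v, ∑ w, α (-d * a * b⁻¹ * v) * β (-d * b * a⁻¹ * w) *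
              ψ (-x / 4 * (d ^ 3 * (a * b)⁻¹) / (-d * a * b⁻¹ * v * (-d * b * a⁻¹ * w)) +
                -d * a * b⁻¹ * v + -d * b * a⁻¹ * w)) := by
            rw [sum_mulChar_mul_gaussSum_inv α β hc, ← sum_comp_mul_left _ hs]
            congr 2
            refine sum_congr rfl fun v _ => ?_
            rw [← sum_comp_mul_left _ ht]
      _ = _ := by
            simp only [mul_sum]
            refine sum_congr rfl fun v _ => sum_congr rfl fun w _ => ?_
            by_cases hv : v = 0
            · simp [hv, MulChar.map_zero]
            by_cases hw : w = 0
            · simp [hw, MulChar.map_zero]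
            have e : d * (1 + a⁻¹ + b⁻¹ - x / (4 * v * w) * (a * b)⁻¹ - v * a * b⁻¹ - w * b * a⁻¹) =
              (d + d * a⁻¹ + d * b⁻¹) +
              (-x / 4 * (d ^ 3 * (a * b)⁻¹) / (-d * a * b⁻¹ * v * (-d * b * a⁻¹ * w)) +
                -d * a * b⁻¹ * v + -d * b * a⁻¹ * w) := by
                field_simp; ring
            rw [e, AddChar.map_add_eq_mul ψ (d + d * a⁻¹ + d * b⁻¹)]
            have hcoef := mulChar_coeff α β hd ha hb v w
            generalize ψ (-x / 4 * (d ^ 3 * (a * b)⁻¹) /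
              (-d * a * b⁻¹ * v * (-d * b * a⁻¹ * w)) +
                -d * a * b⁻¹ * v + -d * b * a⁻¹ * w) = X
            generalize ψ (d + d * a⁻¹ + d * b⁻¹) = Y
            linear_combination (X * Y * (Fintype.card F - 1)) * hcoef
  simp only [hS]
  calc _ = ∑ d, ∑ a, ∑ b, ∑ χ : MulChar F ℂ, χ (-x / 4) *
        (gaussSum χ⁻¹ ψ * gaussSum (α * χ⁻¹) ψ * gaussSum (β * χ⁻¹) ψ) *
        ((quadChar F * α⁻¹ * β⁻¹ * χ) d * (quadChar F * α * β⁻¹ * χ) (d * a⁻¹) *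
        (quadChar F * α⁻¹ * β * χ) (d * b⁻¹) * ψ (d + d * a⁻¹ + d * b⁻¹)) := by
          simp only [mul_sum]
          rw [sum_comm]
          refine sum_congr rfl fun d _ => ?_
          rw [sum_comm]
          refine sum_congr rfl fun a _ => ?_
          rw [sum_comm]
    _ = ∑ a, ∑ b, ∑ v, ∑ w, ∑ d, (Fintype.card F - 1) * (α * β) (-1) * (α v * β w *
        (quadChar F (a * b) * (quadChar F d * ψ (d * (1 + a⁻¹ + b⁻¹ -
          x / (4 * v * w) * (a * b)⁻¹ - v * a * b⁻¹ - w * b * a⁻¹))))) := by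
          simp only [hd]
          rw [sum_comm]
          refine sum_congr rfl fun a _ => ?_
          rw [sum_comm]
          refine sum_congr rfl fun b _ => ?_
          rw [sum_comm]
          refine sum_congr rfl fun v _ => ?_
          rw [sum_comm]
    _ = ∑ a, ∑ b, ∑ v, ∑ w, (Fintype.card F - 1) * (α * β) (-1) * gaussSum (quadChar F) ψ *
          (α v * β w * (quadChar F (a * b) * quadChar F (1 + a⁻¹ + b⁻¹ -
          x / (4 * v * w) * (a * b)⁻¹ - v * a * b⁻¹ - w * b * a⁻¹))) := by
          refine sum_congr rfl fun a _ => sum_congr rfl fun b _ => sum_congr rfl fun v _ =>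
            sum_congr rfl fun w _ => ?_
          rw [← mul_sum, ← mul_sum, ← mul_sum,
            sum_mulChar_mul_addChar_mul' (quadChar_ne_one h2), quadChar_inv]
          ring
    _ = ∑ v, ∑ w, ∑ a, ∑ b, (Fintype.card F - 1) * (α * β) (-1) * gaussSum (quadChar F) ψ *
          (α v * β w * (quadChar F (a * b) * quadChar F (1 + a⁻¹ + b⁻¹ -
          x / (4 * v * w) * (a * b)⁻¹ - v * a * b⁻¹ - w * b * a⁻¹))) := by
          rw [sum_congr rfl fun a _ => sum_comm, sum_comm]
          refine sum_congr rfl fun v _ => ?_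
          rw [sum_congr rfl fun a _ => sum_comm, sum_comm]
    _ = _ := by
          simp only [← mul_sum, ternarySum]

/-- The identity behind the cubic transformation, in terms of Gauss sums. -/
theorem cubic_gaussSum_identity (h2 : (2 : F) ≠ 0) {α β : MulChar F ℂ} (hα : α * quadChar F ≠ 1)
    (hβ : β * quadChar F ≠ 1) (hαβ : α⁻¹ * β * quadChar F ≠ 1) {x : F} (hx : x ≠ 0) :
    ∑ χ : MulChar F ℂ, χ (x / 4) *
        (gaussSum χ⁻¹ ψ * gaussSum (α * χ⁻¹) ψ * gaussSum (β * χ⁻¹) ψ) *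
        ∑ y, (quadChar F * α⁻¹ * β⁻¹ * χ ^ 3) y * ψ (y * (1 - x)) =
      (quadChar F * α⁻¹ * β⁻¹) (-1) / Fintype.card F * ∑ χ : MulChar F ℂ, χ (-x / 4) *
        (gaussSum χ⁻¹ ψ * gaussSum (α * χ⁻¹) ψ * gaussSum (β * χ⁻¹) ψ) *
        (gaussSum (quadChar F * α⁻¹ * β⁻¹ * χ) ψ * gaussSum (quadChar F * α * β⁻¹ * χ) ψ *
          gaussSum (quadChar F * α⁻¹ * β * χ) ψ) -
      if x = -1 / 2 then (Fintype.card F - 1) * Fintype.card F *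
        (quadChar F * α⁻¹ * β⁻¹) (-2) * gaussSum (quadChar F) ψ else 0 := by
  rw [sum_gaussSum_mul_sum_addChar h2 α β hx, sum_six_gaussSum h2 α β hx,
    sum_mul_ternarySum h2 hα hβ hαβ hx]
  have hq := card_ne_zero' (F := F)
  have hm1 : (-1 : F) ≠ 0 := by simp
  have hC1 : (quadChar F * α⁻¹ * β⁻¹) (-1) * (α * β) (-1) = quadChar F (-1) := by
    simp only [MulChar.mul_apply, mulChar_inv_apply]
    have := mulChar_ne_zero α hm1
    have := mulChar_ne_zero β hm1
    field_simp
  have h1 := quadChar_mul_self hm1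
  have hC2 : quadChar F (-1) * quadChar F 2 * (α * β) (-1 / 2) =
      (quadChar F * α⁻¹ * β⁻¹) (-2) := by
    have e : (-1 / 2 : F) = (-2)⁻¹ := by rw [inv_neg, neg_div, one_div]
    rw [e, ← MulChar.inv_apply', ← map_mul, neg_one_mul, mul_assoc (quadChar F), ← mul_inv,
      MulChar.mul_apply (quadChar F)]
  rw [← hC2]
  generalize ∑ v, ∑ w, α v * β w * quadChar F (1 - x + x / (4 * v * w) + v + w) = S
  have e : ∀ Y : ℂ, (quadChar F * α⁻¹ * β⁻¹) (-1) / Fintype.card F * ((Fintype.card F - 1) *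
      (α * β) (-1) * gaussSum (quadChar F) ψ * (Fintype.card F * quadChar F (-1) * S + Y)) =
      (Fintype.card F - 1) * gaussSum (quadChar F) ψ *
        ((quadChar F * α⁻¹ * β⁻¹) (-1) * (α * β) (-1)) *
        (quadChar F (-1) * S + Y / Fintype.card F) := by
    intro Y
    field_simp
  rw [e, hC1]
  split_ifs
  · rw [sq, mul_assoc (Fintype.card F : ℂ) _ (quadChar F 2), mul_assoc (Fintype.card F : ℂ) _ (_),
      mul_div_cancel_left₀ _ hq]
    linear_combination (-gaussSum (quadChar F) ψ * (Fintype.card F - 1) * S) * h1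
  · rw [zero_div]
    linear_combination (-gaussSum (quadChar F) ψ * (Fintype.card F - 1) * S) * h1

/-! ### Hypergeometric functions as sums of Gauss sums. -/

/-- The finite field binomial theorem: Fourier expansion on the multiplicative group, with Jacobi
sums as binomial coefficients. -/
lemma card_sub_one_mul_apply_one_sub (χ₀ : MulChar F ℂ) {u : F} (hu : u ≠ 0) :
    (Fintype.card F - 1) * χ₀ (1 - u) = ∑ χ : MulChar F ℂ, jacobiSum χ₀ χ⁻¹ * χ u := by
  have key : ∀ χ : MulChar F ℂ, jacobiSum χ₀ χ⁻¹ * χ u =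
      ∑ t, χ₀ t * χ (u * (1 - t)⁻¹) := by
    intro χ
    rw [jacobiSum, sum_mul]
    refine sum_congr rfl fun t _ => ?_
    rw [map_mul, MulChar.inv_apply']
    ring
  have hiff : ∀ t : F, u * (1 - t)⁻¹ = 1 ↔ t = 1 - u := by
    intro t
    by_cases ht : 1 - t = 0
    · rw [ht, inv_zero, mul_zero]
      refine iff_of_false zero_ne_one fun h => hu ?_
      linear_combination ht + h
    · rw [← div_eq_mul_inv, div_eq_one_iff_eq ht]
      constructor <;> intro h <;> linear_combination h
  simp only [key]
  rw [sum_comm]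
  simp only [← mul_sum, sum_mulChar_apply, hiff]
  simp [mul_comm]

lemma period_two (A₁ A₂ A₃ B₁ B₂ : MulChar F ℂ) (x : F) :
    period 2 ![A₁, A₂, A₃] ![B₁, B₂] x =
      ∑ y, A₃ y * (A₃⁻¹ * B₂) (1 - y) * ∑ z, A₂ z * (A₂⁻¹ * B₁) (1 - z) * A₁⁻¹ (1 - x * y * z) :=
  rfl

lemma hypF_two (A₁ A₂ A₃ B₁ B₂ : MulChar F ℂ) (x : F) :
    hypF 2 ![A₁, A₂, A₃] ![B₁, B₂] x =
      period 2 ![A₁, A₂, A₃] ![B₁, B₂] x /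
        (jacobiSum A₂ (A₂⁻¹ * B₁) * jacobiSum A₃ (A₃⁻¹ * B₂)) := by
  rw [hypF, Fin.prod_univ_two, mul_comm A₂⁻¹, mul_comm A₃⁻¹,
    div_eq_mul_one_div (period 2 ![A₁, A₂, A₃] ![B₁, B₂] x), mul_comm]
  rfl

lemma jacobiSum_ne_zero (hψ : ψ.IsPrimitive) {χ θ : MulChar F ℂ} (h : χ ≠ 1 ∨ θ ≠ 1) :
    jacobiSum χ θ ≠ 0 := by
  have h1 := card_mul_jacobiSum hψ h
  refine right_ne_zero_of_mul (a := (Fintype.card F : ℂ)) ?_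
  rw [h1]
  exact mul_ne_zero (mul_ne_zero (mul_ne_zero (mulChar_ne_zero _ (by simp))
    (gaussSum_ne_zero hψ _)) (gaussSum_ne_zero hψ _)) (gaussSum_ne_zero hψ _)

lemma hypF_two_zero (hψ : ψ.IsPrimitive) {A₁ A₂ A₃ B₁ B₂ : MulChar F ℂ}
    (h₂ : A₂⁻¹ * B₁ ≠ 1) (h₃ : A₃⁻¹ * B₂ ≠ 1) :
    hypF 2 ![A₁, A₂, A₃] ![B₁, B₂] 0 = 1 := by
  rw [hypF_two, period_two, div_eq_one_iff_eq
    (mul_ne_zero (jacobiSum_ne_zero hψ (Or.inr h₂)) (jacobiSum_ne_zero hψ (Or.inr h₃)))]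
  simp only [zero_mul, sub_zero, map_one, mul_one, ← sum_mul, jacobiSum]
  ring

/-- Expanding the innermost factor by the binomial theorem separates y from z, and each variable
yields a Jacobi sum. -/
lemma card_sub_one_mul_period_two (A₁ A₂ A₃ B₁ B₂ : MulChar F ℂ) {x : F} (hx : x ≠ 0) :
    (Fintype.card F - 1) * period 2 ![A₁, A₂, A₃] ![B₁, B₂] x =
      ∑ χ : MulChar F ℂ, χ x * jacobiSum A₁⁻¹ χ⁻¹ * jacobiSum (A₂ * χ) (A₂⁻¹ * B₁) *
        jacobiSum (A₃ * χ) (A₃⁻¹ * B₂) := by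
  calc _ = ∑ y, ∑ z, ∑ χ : MulChar F ℂ, χ x * jacobiSum A₁⁻¹ χ⁻¹ *
        ((A₂ * χ) z * (A₂⁻¹ * B₁) (1 - z)) * ((A₃ * χ) y * (A₃⁻¹ * B₂) (1 - y)) := by
        rw [period_two, mul_sum]
        refine sum_congr rfl fun y _ => ?_
        rw [mul_sum, mul_sum]
        refine sum_congr rfl fun z _ => ?_
        by_cases hy : y = 0
        · simp [hy, MulChar.map_zero]
        by_cases hz : z = 0
        · simp [hz, MulChar.map_zero]
        have h := card_sub_one_mul_apply_one_sub A₁⁻¹ (mul_ne_zero (mul_ne_zero hx hy) hz)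
        calc _ = A₃ y * (A₃⁻¹ * B₂) (1 - y) * (A₂ z * (A₂⁻¹ * B₁) (1 - z)) *
              ((Fintype.card F - 1) * A₁⁻¹ (1 - x * y * z)) := by ring
          _ = _ := by
            rw [h, mul_sum]
            refine sum_congr rfl fun χ _ => ?_
            simp only [map_mul, MulChar.mul_apply _ χ]
            ring
    _ = _ := by
        rw [sum_congr rfl fun y _ => sum_comm, sum_comm]
        refine sum_congr rfl fun χ _ => ?_
        simp only [jacobiSum, ← sum_mul, ← mul_sum]

/-- The hypergeometric function `₃𝔽₂` as a sum of products of Gauss sums. -/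
lemma hypF_two_eq_sum_gaussSum (hψ : ψ.IsPrimitive) {A₁ A₂ A₃ B₁ B₂ : MulChar F ℂ} (h₁ : A₁ ≠ 1)
    (h₂ : A₂⁻¹ * B₁ ≠ 1) (h₃ : A₃⁻¹ * B₂ ≠ 1) {x : F} (hx : x ≠ 0) :
    hypF 2 ![A₁, A₂, A₃] ![B₁, B₂] x =
      (∑ χ : MulChar F ℂ, χ (-x) * gaussSum χ⁻¹ ψ *
        (gaussSum (A₁ * χ) ψ * gaussSum (A₂ * χ) ψ * gaussSum (A₃ * χ) ψ) *
        (gaussSum (B₁⁻¹ * χ⁻¹) ψ * gaussSum (B₂⁻¹ * χ⁻¹) ψ)) /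
      ((Fintype.card F - 1) * (gaussSum A₁ ψ * gaussSum A₂ ψ * gaussSum A₃ ψ) *
        (gaussSum B₁⁻¹ ψ * gaussSum B₂⁻¹ ψ)) := by
  have hq := card_ne_zero' (F := F)
  have hq1 := card_sub_one_ne_zero (F := F)
  have hg := fun χ : MulChar F ℂ => gaussSum_ne_zero hψ χ
  -- The ratio of the Jacobi sum shifted by χ to the normalizing one; the Gauss sum of `A⁻¹ * B`
  -- common to both cancels.
  have hJ : ∀ {A B : MulChar F ℂ}, A⁻¹ * B ≠ 1 → ∀ χ : MulChar F ℂ,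
      jacobiSum (A * χ) (A⁻¹ * B) * (gaussSum A ψ * gaussSum B⁻¹ ψ) =
        χ (-1) * (gaussSum (A * χ) ψ * gaussSum (B⁻¹ * χ⁻¹) ψ) * jacobiSum A (A⁻¹ * B) := by
    intro A B h χ
    have e1 := card_mul_jacobiSum hψ (χ := A * χ) (Or.inr h)
    have e2 := card_mul_jacobiSum hψ (χ := A) (Or.inr h)
    rw [show A * χ * (A⁻¹ * B) = B * χ by
        rw [mul_mul_mul_comm, mul_inv_cancel, one_mul, mul_comm],
      mul_inv, MulChar.mul_apply] at e1
    rw [mul_inv_cancel_left] at e2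
    refine mul_left_cancel₀ hq ?_
    linear_combination (gaussSum A ψ * gaussSum B⁻¹ ψ) * e1 -
      (χ (-1) * (gaussSum (A * χ) ψ * gaussSum (B⁻¹ * χ⁻¹) ψ)) * e2
  have hJ1 : ∀ χ : MulChar F ℂ, jacobiSum A₁⁻¹ χ⁻¹ * gaussSum A₁ ψ =
      χ (-1) * (gaussSum χ⁻¹ ψ * gaussSum (A₁ * χ) ψ) := by
    intro χ
    have e1 := card_mul_jacobiSum hψ (χ := A₁⁻¹) (θ := χ⁻¹) (Or.inl (inv_ne_one.mpr h₁))
    have e2 := gaussSum_mul_gaussSum_inv hψ h₁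
    rw [mul_inv, inv_inv, inv_inv, MulChar.mul_apply, MulChar.inv_apply', MulChar.inv_apply',
      inv_neg_one] at e1
    refine mul_left_cancel₀ hq ?_
    linear_combination gaussSum A₁ ψ * e1 + (A₁ (-1) * χ (-1) * gaussSum χ⁻¹ ψ *
      gaussSum (A₁ * χ) ψ) * e2 + Fintype.card F * χ (-1) * gaussSum χ⁻¹ ψ *
      gaussSum (A₁ * χ) ψ * mulChar_neg_one_mul_self A₁
  have hJ2 := jacobiSum_ne_zero hψ (χ := A₂) (Or.inr h₂)
  have hJ3 := jacobiSum_ne_zero hψ (χ := A₃) (Or.inr h₃)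
  rw [hypF_two, div_eq_div_iff (mul_ne_zero hJ2 hJ3) (mul_ne_zero (mul_ne_zero hq1
    (mul_ne_zero (mul_ne_zero (hg _) (hg _)) (hg _))) (mul_ne_zero (hg _) (hg _)))]
  have hP := card_sub_one_mul_period_two A₁ A₂ A₃ B₁ B₂ hx
  calc _ = ((Fintype.card F - 1) * period 2 ![A₁, A₂, A₃] ![B₁, B₂] x) *
        ((gaussSum A₁ ψ * gaussSum A₂ ψ * gaussSum A₃ ψ) * (gaussSum B₁⁻¹ ψ * gaussSum B₂⁻¹ ψ)) := by
        ring
    _ = _ := by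
        rw [hP, sum_mul, sum_mul]
        refine sum_congr rfl fun χ _ => ?_
        rw [← neg_one_mul x, map_mul]
        have a1 := hJ1 χ
        have a2 := hJ h₂ χ
        have a3 := hJ h₃ χ
        calc _ = χ x * (jacobiSum A₁⁻¹ χ⁻¹ * gaussSum A₁ ψ) *
              (jacobiSum (A₂ * χ) (A₂⁻¹ * B₁) * (gaussSum A₂ ψ * gaussSum B₁⁻¹ ψ)) *
              (jacobiSum (A₃ * χ) (A₃⁻¹ * B₂) * (gaussSum A₃ ψ * gaussSum B₂⁻¹ ψ)) := by ring
          _ = _ := by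
            rw [a1, a2, a3]
            linear_combination (χ x * χ (-1) * (gaussSum χ⁻¹ ψ * gaussSum (A₁ * χ) ψ) *
              (gaussSum (A₂ * χ) ψ * gaussSum (B₁⁻¹ * χ⁻¹) ψ) * jacobiSum A₂ (A₂⁻¹ * B₁) *
              (gaussSum (A₃ * χ) ψ * gaussSum (B₂⁻¹ * χ⁻¹) ψ) * jacobiSum A₃ (A₃⁻¹ * B₂)) *
              mulChar_neg_one_mul_self χ

/-! ### Specialization to the two sides of the cubic transformation. -/

lemma traceChar_isPrimitive (p : ℕ) [Fact p.Prime] [Algebra (ZMod p) F] {ζ : ℂ}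
    (hζ : IsPrimitiveRoot ζ p) : (traceChar (F := F) p hζ.pow_eq_one).IsPrimitive := by
  refine AddChar.IsPrimitive.of_ne_one ?_
  rw [AddChar.ne_one_iff]
  obtain ⟨a, ha⟩ := DFunLike.ne_iff.mp (Algebra.trace_ne_zero (ZMod p) F)
  refine ⟨a, fun h => ha ?_⟩
  change ζ ^ (Algebra.trace (ZMod p) F a).val = 1 at h
  rw [hζ.pow_eq_one_iff_dvd] at h
  have := Nat.eq_zero_of_dvd_of_lt h (ZMod.val_lt _)
  exact (ZMod.val_eq_zero _).mp this

lemma two_ne_zero_and_three_ne_zero (hq : Fintype.card F ≡ 1 [MOD 6]) :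
    (2 : F) ≠ 0 ∧ (3 : F) ≠ 0 := by
  have h0 := FiniteField.cast_card_eq_zero F
  have h1 : Fintype.card F = 6 * (Fintype.card F / 6) + 1 := by
    have := Nat.div_add_mod (Fintype.card F) 6
    rw [hq] at this
    exact this.symm
  rw [h1] at h0
  push_cast at h0
  generalize ((Fintype.card F / 6 : ℕ) : F) = k at h0
  constructor <;> intro h <;> refine one_ne_zero (α := F) ?_
  · linear_combination h0 - 3 * k * h
  · linear_combination h0 - 2 * k * h

lemma inv_mul_ne_one_of_cubic {η A B : MulChar F ℂ} (hη3 : η ^ 3 = 1)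
    (h₆ : quadChar F * A ^ 3 * B⁻¹ ^ 3 ≠ 1) : (A * η)⁻¹ * (quadChar F * B) ≠ 1 := by
  intro h
  rw [inv_mul_eq_one] at h
  have h' : A ^ 3 = quadChar F * B ^ 3 := by
    have := congrArg (· ^ 3) h
    simp only [mul_pow, hη3, mul_one] at this
    rw [this, pow_succ (quadChar F), sq, quadChar_mul_quadChar, one_mul]
  apply h₆
  rw [h', ← mul_assoc, quadChar_mul_quadChar, one_mul, inv_pow, mul_inv_cancel]

lemma inv_mul_ne_one_of_cubic' {η A B : MulChar F ℂ} (hη3 : η ^ 3 = 1)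
    (h₄ : A ^ 6 * B⁻¹ ^ 3 ≠ 1) : (A * η⁻¹)⁻¹ * (A ^ 3 * B⁻¹) ≠ 1 := by
  intro h
  have := congrArg (· ^ 3) h
  simp only [mul_pow, inv_pow, hη3, mul_one, one_pow, mul_inv, inv_inv] at this
  apply h₄
  rw [inv_pow, ← this, ← mul_assoc, ← pow_mul, show 3 * 3 = 3 + 6 from rfl, pow_add,
    inv_mul_cancel_left]

lemma inv_mul_ne_one_of_ne_one (C : MulChar F ℂ) {B : MulChar F ℂ} (hB : B ≠ 1) :
    (C * B⁻¹ ^ 2)⁻¹ * (C * B⁻¹) ≠ 1 := by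
  intro h
  rw [inv_mul_eq_one, mul_right_inj, sq] at h
  exact hB (inv_eq_one.mp (mul_eq_left.mp h))

lemma inv_mul_ne_one_of_quadChar {C B : MulChar F ℂ} (h₅ : quadChar F * C * B⁻¹ ≠ 1) :
    (C⁻¹ * B ^ 2)⁻¹ * (quadChar F * B) ≠ 1 := by
  intro h
  apply h₅
  rw [← h, mul_inv, inv_inv, sq, mul_inv, mul_comm (quadChar F) B, mul_assoc C (B⁻¹ * B⁻¹),
    ← mul_assoc (B⁻¹ * B⁻¹), inv_mul_cancel_right, mul_comm (quadChar F) C, mul_assoc,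
    mul_comm (quadChar F)]

/-- Hasse–Davenport applied to Aχ contributes χ⁻¹(27), which cancels the 27 in the argument. The
remaining (C χ³)⁻¹(1 - x) with C = `A ^ 3` is absorbed into the Gauss sum of Cχ³ as a shift of ψ. -/
lemma hypF_cubic_left (hψ : ψ.IsPrimitive) (h2 : (2 : F) ≠ 0) (h3 : (3 : F) ≠ 0)
    {η A B : MulChar F ℂ} (hη3 : η ^ 3 = 1) (hη : η ≠ 1) (hA : A ^ 3 ≠ 1)
    (h₄ : A ^ 6 * B⁻¹ ^ 3 ≠ 1) (h₆ : quadChar F * A ^ 3 * B⁻¹ ^ 3 ≠ 1)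
    {x : F} (hx : x ≠ 0) (hx1 : x ≠ 1) :
    ((Fintype.card F - 1) * gaussSum (A ^ 3) ψ * (gaussSum (quadChar F * B⁻¹) ψ *
        gaussSum ((A ^ 3)⁻¹ * B) ψ)) * ((A ^ 3)⁻¹ (1 - x) *
      hypF 2 ![A, A * η, A * η⁻¹] ![quadChar F * B, A ^ 3 * B⁻¹] (27 * x / (4 * (x - 1) ^ 3))) =
    ∑ χ : MulChar F ℂ, χ (x / 4) *
        (gaussSum χ⁻¹ ψ * gaussSum (quadChar F * B⁻¹ * χ⁻¹) ψ *
          gaussSum ((A ^ 3)⁻¹ * B * χ⁻¹) ψ) *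
        ∑ y, (A ^ 3 * χ ^ 3) y * ψ (y * (1 - x)) := by
  have h4 : (4 : F) ≠ 0 := by rw [show (4 : F) = 2 * 2 by norm_num]; exact mul_ne_zero h2 h2
  have h27 : (27 : F) ≠ 0 := by rw [show (27 : F) = 3 ^ 3 by norm_num]; exact pow_ne_zero 3 h3
  have hx1' : 1 - x ≠ 0 := sub_ne_zero.mpr hx1.symm
  have hx1'' : x - 1 ≠ 0 := sub_ne_zero.mpr hx1
  have hl : 27 * x / (4 * (x - 1) ^ 3) ≠ 0 :=
    div_ne_zero (mul_ne_zero h27 hx) (mul_ne_zero h4 (pow_ne_zero 3 hx1''))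
  have c1 : A ≠ 1 := by rintro rfl; exact hA (one_pow 3)
  have c2 := inv_mul_ne_one_of_cubic hη3 h₆
  have c3 := inv_mul_ne_one_of_cubic' hη3 h₄
  rw [hypF_two_eq_sum_gaussSum hψ c1 c2 c3 hl]
  have hq := card_ne_zero' (F := F)
  have hq1 := card_sub_one_ne_zero (F := F)
  have hg := fun χ : MulChar F ℂ => gaussSum_ne_zero hψ χ
  have e1 : (quadChar F * B)⁻¹ = quadChar F * B⁻¹ := by rw [mul_inv, quadChar_inv]
  have e2 : (A ^ 3 * B⁻¹)⁻¹ = (A ^ 3)⁻¹ * B := by rw [mul_inv, inv_inv]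
  rw [e1, e2, gaussSum_mul_gaussSum_mul_gaussSum hψ hη3 hη h3]
  have hterm : ∀ χ : MulChar F ℂ, χ (-(27 * x / (4 * (x - 1) ^ 3))) * gaussSum χ⁻¹ ψ *
        (gaussSum (A * χ) ψ * gaussSum (A * η * χ) ψ * gaussSum (A * η⁻¹ * χ) ψ) *
        (gaussSum (quadChar F * B⁻¹ * χ⁻¹) ψ * gaussSum ((A ^ 3)⁻¹ * B * χ⁻¹) ψ) *
          (A ^ 3)⁻¹ (1 - x) =
      Fintype.card F * A⁻¹ 27 * (χ (x / 4) *
        (gaussSum χ⁻¹ ψ * gaussSum (quadChar F * B⁻¹ * χ⁻¹) ψ *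
          gaussSum ((A ^ 3)⁻¹ * B * χ⁻¹) ψ) *
        ∑ y, (A ^ 3 * χ ^ 3) y * ψ (y * (1 - x))) := by
    intro χ
    rw [mul_right_comm A η, mul_right_comm A η⁻¹, gaussSum_mul_gaussSum_mul_gaussSum hψ hη3 hη h3,
      sum_mulChar_mul_addChar_mul _ hx1', mul_pow A χ 3]
    have k1 : χ (-(27 * x / (4 * (x - 1) ^ 3))) * (A * χ)⁻¹ 27 =
        A⁻¹ 27 * (χ (x / 4) * (χ ^ 3)⁻¹ (1 - x)) := by
      rw [show -(27 * x / (4 * (x - 1) ^ 3)) = 27 * (x / 4) * ((1 - x) ^ 3)⁻¹ by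
        rw [show (1 - x) ^ 3 = -(x - 1) ^ 3 by ring]
        field_simp, map_mul, map_mul, ← MulChar.inv_apply']
      simp only [mulChar_inv_apply, MulChar.mul_apply, mulChar_pow_apply χ three_ne_zero, map_pow]
      have := mulChar_ne_zero χ h27
      field_simp
    rw [mul_inv (A ^ 3), MulChar.mul_apply (A ^ 3)⁻¹]
    linear_combination (Fintype.card F * gaussSum (A ^ 3 * χ ^ 3) ψ * gaussSum χ⁻¹ ψ *
      (gaussSum (quadChar F * B⁻¹ * χ⁻¹) ψ * gaussSum ((A ^ 3)⁻¹ * B * χ⁻¹) ψ) *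
          (A ^ 3)⁻¹ (1 - x)) * k1
  have hsum := Fintype.sum_congr _ _ hterm
  rw [← sum_mul, ← mul_sum] at hsum
  have hA27 := mulChar_ne_zero A⁻¹ h27
  have n1 := hg (A ^ 3)
  have n2 := hg (quadChar F * B⁻¹)
  have n3 := hg ((A ^ 3)⁻¹ * B)
  refine mul_left_cancel₀ (mul_ne_zero hq hA27) ?_
  rw [← hsum]
  field_simp

/-- The second and third upper characters are mutually inverse, so their Gauss sums in the
normalization multiply to C(-1) q. -/
lemma hypF_cubic_right (hψ : ψ.IsPrimitive) (h2 : (2 : F) ≠ 0) {C B : MulChar F ℂ} (hC : C ≠ 1)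
    (hB : B ≠ 1) (h₃ : C * B⁻¹ ^ 2 ≠ 1) (h₅ : quadChar F * C * B⁻¹ ≠ 1) {x : F} (hx : x ≠ 0) :
    ((Fintype.card F - 1) * gaussSum C ψ * (gaussSum (quadChar F * B⁻¹) ψ *
        gaussSum (C⁻¹ * B) ψ)) *
      hypF 2 ![C, C * B⁻¹ ^ 2, C⁻¹ * B ^ 2] ![C * B⁻¹, quadChar F * B] (x / 4) =
    C (-1) / Fintype.card F * ∑ χ : MulChar F ℂ, χ (-x / 4) *
        (gaussSum χ⁻¹ ψ * gaussSum (quadChar F * B⁻¹ * χ⁻¹) ψ * gaussSum (C⁻¹ * B * χ⁻¹) ψ) *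
        (gaussSum (C * χ) ψ * gaussSum (C * B⁻¹ ^ 2 * χ) ψ * gaussSum (C⁻¹ * B ^ 2 * χ) ψ) := by
  have h4 : (4 : F) ≠ 0 := by rw [show (4 : F) = 2 * 2 by norm_num]; exact mul_ne_zero h2 h2
  have c2 := inv_mul_ne_one_of_ne_one C hB
  have c3 := inv_mul_ne_one_of_quadChar h₅
  have hq := card_ne_zero' (F := F)
  have hq1 := card_sub_one_ne_zero (F := F)
  have hg := fun χ : MulChar F ℂ => gaussSum_ne_zero hψ χ
  rw [hypF_two_eq_sum_gaussSum hψ hC c2 c3 (div_ne_zero hx h4)]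
  have e1 : (quadChar F * B)⁻¹ = quadChar F * B⁻¹ := by rw [mul_inv, quadChar_inv]
  have e2 : (C * B⁻¹)⁻¹ = C⁻¹ * B := by rw [mul_inv, inv_inv]
  have e3 : gaussSum (C * B⁻¹ ^ 2) ψ * gaussSum (C⁻¹ * B ^ 2) ψ = C (-1) * Fintype.card F := by
    have := gaussSum_mul_gaussSum_inv hψ h₃
    rw [mul_inv, inv_pow, inv_inv, MulChar.mul_apply, mulChar_inv_apply,
      mulChar_pow_apply B two_ne_zero, sq (B (-1)), mulChar_neg_one_mul_self, inv_one, mul_one] at this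
    rwa [inv_pow]
  have e4 := mulChar_neg_one_mul_self C
  have e5 : C (-1) ≠ 0 := mulChar_ne_zero C (by simp)
  rw [e1, e2, mul_assoc (gaussSum C ψ), e3, neg_div]
  have hsum : ∑ χ : MulChar F ℂ, χ (-(x / 4)) * gaussSum χ⁻¹ ψ *
        (gaussSum (C * χ) ψ * gaussSum (C * B⁻¹ ^ 2 * χ) ψ * gaussSum (C⁻¹ * B ^ 2 * χ) ψ) *
        (gaussSum (C⁻¹ * B * χ⁻¹) ψ * gaussSum (quadChar F * B⁻¹ * χ⁻¹) ψ) =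
      ∑ χ : MulChar F ℂ, χ (-(x / 4)) *
        (gaussSum χ⁻¹ ψ * gaussSum (quadChar F * B⁻¹ * χ⁻¹) ψ * gaussSum (C⁻¹ * B * χ⁻¹) ψ) *
        (gaussSum (C * χ) ψ * gaussSum (C * B⁻¹ ^ 2 * χ) ψ * gaussSum (C⁻¹ * B ^ 2 * χ) ψ) :=
    Fintype.sum_congr _ _ fun χ => by ring
  rw [hsum]
  generalize ∑ χ : MulChar F ℂ, χ (-(x / 4)) *
        (gaussSum χ⁻¹ ψ * gaussSum (quadChar F * B⁻¹ * χ⁻¹) ψ * gaussSum (C⁻¹ * B * χ⁻¹) ψ) *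
        (gaussSum (C * χ) ψ * gaussSum (C * B⁻¹ ^ 2 * χ) ψ * gaussSum (C⁻¹ * B ^ 2 * χ) ψ) = S
  have n1 := hg C
  have n2 := hg (quadChar F * B⁻¹)
  have n3 := hg (C⁻¹ * B)
  field_simp
  linear_combination -S * e4

/-- This is the x = 1 case of the weighted sum: ψ drops out, and orthogonality in y retains only the
χ with Cχ³ trivial. -/
lemma sum_addChar_zero_weight (C : MulChar F ℂ) (a : MulChar F ℂ → ℂ) :
    ∑ χ : MulChar F ℂ, χ (1 / 4) * a χ * ∑ y, (C * χ ^ 3) y * ψ (y * (1 - 1)) =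
      (Fintype.card F - 1) * ∑ χ : MulChar F ℂ with χ ^ 3 = C⁻¹, a χ * χ⁻¹ 4 := by
  rw [sum_filter, mul_sum]
  refine sum_congr rfl fun χ _ => ?_
  simp only [sub_self, mul_zero, AddChar.map_zero_eq_one, mul_one]
  split_ifs with h
  · rw [h, mul_inv_cancel, MulChar.sum_one_eq_card_units, Fintype.card_units,
      Nat.cast_sub Fintype.card_pos, Nat.cast_one, MulChar.inv_apply', one_div]
    ring
  · rw [MulChar.sum_eq_zero_of_ne_one fun h' => h (eq_inv_of_mul_eq_one_right h')]
    simp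

/-- The Gauss sum identity with α = φB⁻¹ and β = C⁻¹B, whose three nontriviality conditions become
those on B, φCB⁻¹ and CB⁻². The value x = 1 is allowed, which is what gives the evaluation at 1/4.
-/
lemma cubic_transformation_eq (hψ : ψ.IsPrimitive) (h2 : (2 : F) ≠ 0) {C B : MulChar F ℂ}
    (hC : C ≠ 1) (hB : B ≠ 1) (h₃ : C * B⁻¹ ^ 2 ≠ 1) (h₅ : quadChar F * C * B⁻¹ ≠ 1) {x : F}
    (hx : x ≠ 0) :
    ∑ χ : MulChar F ℂ, χ (x / 4) *
        (gaussSum χ⁻¹ ψ * gaussSum (quadChar F * B⁻¹ * χ⁻¹) ψ * gaussSum (C⁻¹ * B * χ⁻¹) ψ) *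
        ∑ y, (C * χ ^ 3) y * ψ (y * (1 - x)) =
      ((Fintype.card F - 1) * gaussSum C ψ * (gaussSum (quadChar F * B⁻¹) ψ *
        gaussSum (C⁻¹ * B) ψ)) *
      (hypF 2 ![C, C * B⁻¹ ^ 2, C⁻¹ * B ^ 2] ![C * B⁻¹, quadChar F * B] (x / 4) -
        delta (x + 1 / 2) * C 2 * (gaussSum (quadChar F) ψ * gaussSum C⁻¹ ψ /
          (gaussSum (quadChar F * B⁻¹) ψ * gaussSum (C⁻¹ * B) ψ))) := by
  have hφ := quadChar_mul_quadChar (F := F)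
  have k1 : quadChar F * (quadChar F * B⁻¹)⁻¹ * (C⁻¹ * B)⁻¹ = C := by
    rw [mul_inv, quadChar_inv, ← mul_assoc, hφ, one_mul, inv_inv, mul_inv, inv_inv, mul_comm C,
      mul_inv_cancel_left]
  have k2 : quadChar F * (quadChar F * B⁻¹) * (C⁻¹ * B)⁻¹ = C * B⁻¹ ^ 2 := by
    rw [← mul_assoc, hφ, one_mul, mul_inv, inv_inv, mul_left_comm, sq]
  have k3 : quadChar F * (quadChar F * B⁻¹)⁻¹ * (C⁻¹ * B) = C⁻¹ * B ^ 2 := by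
    rw [mul_inv, quadChar_inv, ← mul_assoc (quadChar F) (quadChar F), hφ, one_mul, inv_inv,
      mul_left_comm, sq]
  have hα : quadChar F * B⁻¹ * quadChar F ≠ 1 := by
    rw [mul_right_comm, hφ, one_mul]
    exact inv_ne_one.mpr hB
  have hβ : C⁻¹ * B * quadChar F ≠ 1 := fun h => h₅ (by
    rw [← inv_eq_one, ← h, mul_inv, mul_inv, inv_inv, quadChar_inv, mul_comm (quadChar F),
      mul_right_comm])
  have hαβ : (quadChar F * B⁻¹)⁻¹ * (C⁻¹ * B) * quadChar F ≠ 1 := fun h => h₃ (by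
    rw [mul_comm, ← mul_assoc, k3] at h
    rw [← inv_eq_one, ← h, mul_inv, inv_pow, inv_inv])
  have key := cubic_gaussSum_identity (ψ := ψ) h2 hα hβ hαβ hx
  rw [k1, k2, k3] at key
  rw [key, mul_sub, hypF_cubic_right hψ h2 hC hB h₃ h₅ hx]
  congr 1
  have hd : x + 1 / 2 = 0 ↔ x = -1 / 2 := by
    rw [add_eq_zero_iff_eq_neg, neg_div]
  simp only [delta, hd]
  split_ifs
  · have e := gaussSum_mul_gaussSum_inv hψ hC
    have n2 := gaussSum_ne_zero hψ (quadChar F * B⁻¹)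
    have n3 := gaussSum_ne_zero hψ (C⁻¹ * B)
    rw [← neg_one_mul (2 : F), map_mul]
    field_simp
    linear_combination (-(Fintype.card F - 1) * C 2 * gaussSum (quadChar F) ψ) * e
  · ring

end FFHyp


theorem mainTheorem7 {F : Type*} [Field F] [Fintype F] [DecidableEq F]
    (p : ℕ) [Fact p.Prime] [Algebra (ZMod p) F] {ζ : ℂ} (hζ : IsPrimitiveRoot ζ p)
    (hq : Fintype.card F ≡ 1 [MOD 6])
    (φ : MulChar F ℂ) (hφ : φ = FFHyp.quadChar F)
    (g : MulChar F ℂ → ℂ) (hg : g = FFHyp.gauss p hζ.pow_eq_one)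
    (η A B : MulChar F ℂ) (hη : orderOf η = 3)
    (h₁ : A ^ 3 ≠ 1) (h₂ : B ≠ 1) (h₃ : A ^ 3 * B⁻¹ ^ 2 ≠ 1) (h₄ : A ^ 6 * B⁻¹ ^ 3 ≠ 1)
    (h₅ : φ * A ^ 3 * B⁻¹ ≠ 1) (h₆ : φ * A ^ 3 * B⁻¹ ^ 3 ≠ 1) :
    (∀ x : F,
      (A⁻¹ ^ 3) (1 - x) *
          FFHyp.hypF 2 ![A, A * η, A * η⁻¹] ![φ * B, A ^ 3 * B⁻¹] (27 * x / (4 * (x - 1) ^ 3)) =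
        FFHyp.hypF 2 ![A ^ 3, A ^ 3 * B⁻¹ ^ 2, A⁻¹ ^ 3 * B ^ 2] ![A ^ 3 * B⁻¹, φ * B] (x / 4)
        - FFHyp.delta (x + 1 / 2) * (A ^ 3) 2 *
            (g φ * g (A⁻¹ ^ 3) / (g (φ * B⁻¹) * g (A⁻¹ ^ 3 * B)))
        - FFHyp.delta (1 - x) * ∑ χ : MulChar F ℂ with χ ^ 3 = A⁻¹ ^ 3,
            g χ⁻¹ * g (φ * (B * χ)⁻¹) * g (B * (A ^ 3 * χ)⁻¹) /
              (g (φ * B⁻¹) * g (A⁻¹ ^ 3 * B) * g (A ^ 3)) * χ⁻¹ 4) ∧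
    FFHyp.hypF 2 ![A ^ 3, A ^ 3 * B⁻¹ ^ 2, A⁻¹ ^ 3 * B ^ 2] ![A ^ 3 * B⁻¹, φ * B] (1 / 4) =
      ∑ χ : MulChar F ℂ with χ ^ 3 = A⁻¹ ^ 3,
        g χ⁻¹ * g (φ * (B * χ)⁻¹) * g (B * (A ^ 3 * χ)⁻¹) /
          (g (φ * B⁻¹) * g (A⁻¹ ^ 3 * B) * g (A ^ 3)) * χ⁻¹ 4 := by
  obtain ⟨h2, h3⟩ := FFHyp.two_ne_zero_and_three_ne_zero hq
  have hψ := FFHyp.traceChar_isPrimitive (F := F) p hζ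
  have hg' : ∀ χ, g χ = gaussSum χ (FFHyp.traceChar p hζ.pow_eq_one) := fun χ => by rw [hg]; rfl
  have hη3 : η ^ 3 = 1 := by rw [← hη]; exact pow_orderOf_eq_one η
  have hη1 : η ≠ 1 := by rintro rfl; simp at hη
  subst hφ
  simp only [hg', inv_pow A 3]
  generalize FFHyp.traceChar (F := F) p hζ.pow_eq_one = ψ at hψ
  have hS : ∀ χ : MulChar F ℂ,
      gaussSum χ⁻¹ ψ * gaussSum (FFHyp.quadChar F * (B * χ)⁻¹) ψ * gaussSum (B * (A ^ 3 * χ)⁻¹) ψ /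
        (gaussSum (FFHyp.quadChar F * B⁻¹) ψ * gaussSum ((A ^ 3)⁻¹ * B) ψ * gaussSum (A ^ 3) ψ) *
        χ⁻¹ 4 =
      (gaussSum (A ^ 3) ψ * (gaussSum (FFHyp.quadChar F * B⁻¹) ψ *
        gaussSum ((A ^ 3)⁻¹ * B) ψ))⁻¹ *
      ((gaussSum χ⁻¹ ψ * gaussSum (FFHyp.quadChar F * B⁻¹ * χ⁻¹) ψ *
        gaussSum ((A ^ 3)⁻¹ * B * χ⁻¹) ψ) * χ⁻¹ 4) := by
    intro χ
    rw [mul_inv B, ← mul_assoc (FFHyp.quadChar F), mul_inv (A ^ 3), mul_left_comm, ← mul_assoc,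
      div_eq_mul_inv, mul_comm (gaussSum (A ^ 3) ψ), mul_comm _ (_⁻¹ : ℂ), mul_assoc]
  simp only [hS, ← mul_sum]
  have hq1 := FFHyp.card_sub_one_ne_zero (F := F)
  have n1 := FFHyp.gaussSum_ne_zero hψ (A ^ 3)
  have n2 := FFHyp.gaussSum_ne_zero hψ (FFHyp.quadChar F * B⁻¹)
  have n3 := FFHyp.gaussSum_ne_zero hψ ((A ^ 3)⁻¹ * B)
  have n := mul_ne_zero n1 (mul_ne_zero n2 n3)
  have hD := mul_ne_zero (mul_ne_zero hq1 n1) (mul_ne_zero n2 n3)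
  have hone := FFHyp.cubic_transformation_eq hψ h2 h₁ h₂ h₃ h₅ (x := 1) one_ne_zero
  rw [FFHyp.sum_addChar_zero_weight] at hone
  -- The points 1 and -1/2 would coincide only in characteristic 3.
  have hδ : FFHyp.delta ((1 : F) + 1 / 2) = 0 := by
    refine if_neg fun h => h3 ?_
    field_simp at h
    linear_combination h
  rw [hδ, zero_mul, zero_mul, sub_zero, mul_assoc, mul_assoc] at hone
  have hone' : FFHyp.hypF 2 ![A ^ 3, A ^ 3 * B⁻¹ ^ 2, (A ^ 3)⁻¹ * B ^ 2]
      ![A ^ 3 * B⁻¹, FFHyp.quadChar F * B] (1 / 4) = _ :=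
    (eq_inv_mul_iff_mul_eq₀ n).mpr ((mul_assoc _ _ _).trans (mul_left_cancel₀ hq1 hone).symm)
  refine ⟨fun x => ?_, hone'⟩
  -- The character expansions need a nonzero argument; at x = 0 both functions equal 1 and both
  -- deltas vanish.
  by_cases hx0 : x = 0
  · subst hx0
    rw [mul_zero, zero_div, zero_div, sub_zero, map_one, one_mul, zero_add,
      FFHyp.hypF_two_zero hψ (FFHyp.inv_mul_ne_one_of_cubic hη3 h₆)
        (FFHyp.inv_mul_ne_one_of_cubic' hη3 h₄),
      FFHyp.hypF_two_zero hψ (FFHyp.inv_mul_ne_one_of_ne_one _ h₂)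
        (FFHyp.inv_mul_ne_one_of_quadChar h₅)]
    simp [FFHyp.delta, h2]
  -- The left side is 0 because its prefactor is a character value at 0, whatever value division by
  -- zero gives the argument.
  by_cases hx1 : x = 1
  · subst hx1
    rw [sub_self, MulChar.map_zero, zero_mul, hone', hδ]
    simp [FFHyp.delta]
  have hL := FFHyp.hypF_cubic_left hψ h2 h3 hη3 hη1 h₁ h₄ h₆ hx0 hx1
  rw [FFHyp.cubic_transformation_eq hψ h2 h₁ h₂ h₃ h₅ hx0] at hL
  have hδ' : FFHyp.delta (1 - x) = 0 := if_neg (sub_ne_zero.mpr (Ne.symm hx1))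
  rw [mul_left_cancel₀ hD hL, hδ', zero_mul, sub_zero]
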